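/- Let $X, X_1, X_2, \dots$ be i.i.d. random vectors in $\mathbb{R}^d$, let $\|\cdot\|$ be the Euclidean norm, $R=\|X\|$, $R_i=\|X_i\|$. Assume that $X$ is regularly varying with a non-degenerate (i.e. non-zero) limit measure $\mu$ on $\mathbb{R}^d\setminus\{0\}$: $\mu$ is finite on Borel sets bounded away from $0$, and for every Borel set $B$ bounded away from $0$ with $\mu(\partial B)=0$, $$\lim_{t\to\infty}\frac{P\{X/t\in B\}}{P\{R>t\}}=\mu(B)<\infty .$$ Assume that the distribution function of $R$ is continuous on $[r_0,\infty)$ for some $r_0$, i.e. $P\{R=r\}=0$ for all $r\ge r_0$. Let $\omega:\mathbb{R}^d\to(0,\infty)$ be a measurable scaling function, write $\theta(x)=\omega(x)x$, $\Theta=\theta(X)$, $\Theta_i=\theta(X_i)$, and assume that $\Theta$ is (almost surely) bounded and that, for $\mu$-almost every $x$ with $\|x\|>1$, $t\,\omega(ty)\to\omega(x)$ as $t\to\infty$ and $y\to x$. (This holds in particular if $\omega$ is homogeneous of order $-1$ on $\mathbb{R}^d\setminus\{0\}$ and $\mu$-almost everywhere continuous, e.g. $\omega(x)=1/\|x\|$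 for $x\neq0$.) Let $k=k_n$ be integers with $k_n\to\infty$ and $k_n/n\to0$. Let $t_{n,k}=\inf\{r: P\{R\le r\}\ge 1-k/n\}$ be the $(1-k/n)$-quantile of $R$ and $\hat t_{n,k}$ the $(k+1)$-th largest of $R_1,\dots,R_n$. Write $E_t(\cdot)=E(\cdot\mid R>t)$ and $$\Sigma_{n,k}=E_{t_{n,k}}(\Theta\Theta^\top),\qquad \hat\Sigma_{n,k}=\frac1k\sum_{i=1}^n\Theta_i\Theta_i^\top\mathbf 1\{R_i>\hat t_{n,k}\}.$$ Assume that there is $\varepsilon>0$ such that, in operator norm, $$\sup_{s\in[1-\varepsilon,1+\varepsilon]}\big\|E_{s t_{n,k}}(\Theta\Theta^\top)-\Sigma_{n,k}\big\|_{op}=o(k^{-1/2})\qquad(n\to\infty).$$ Then $$k^{1/2}\big(\hat\Sigma_{n,k}-\Sigma_{n,k}\big)\to \mathbf U\quad\text{weakly},$$ where $\mathbf U=(U_{ij})_{1\le i,j\le d}$ is a symmetric centered Gaussian random matrix with $$\operatorname{Cov}(U_{ij},U_{\ell m})=\operatorname{Cov}_\infty(\theta_i\theta_j,\theta_\ell\theta_m)\qquad\text{for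 all }1\le i,j,\ell,m\le d,$$ and $\operatorname{Cov}_\infty$ denotes the covariance of functions of $x$ under $\mu$ restricted to $\{x:\|x\|>1\}$ (a probability measure). -/

import Mathlib

open MeasureTheory ProbabilityTheory Filter Topology

noncomputable section

/-- The random vector `X` is regularly varying (with respect to the Euclidean norm) with
non-degenerate limit measure `μ` on `ℝ^d \ {0}`. A measure on `ℝ^d \ {0}` is encoded as a measure on
`ℝ^d` that gives no mass to the origin; a set is bounded away from `0` when `0` is not in its
closure. -/
structure IsRegularlyVarying {Ω : Type*} [MeasurableSpace Ω] {d : ℕ} (P : Measure Ω)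
    (X : Ω → EuclideanSpace ℝ (Fin d)) (μ : Measure (EuclideanSpace ℝ (Fin d))) : Prop where
  measure_zero : μ {0} = 0
  nondegenerate : μ ≠ 0
  finite_away : ∀ B : Set (EuclideanSpace ℝ (Fin d)), MeasurableSet B → 0 ∉ closure B → μ B < ⊤
  tendsto : ∀ B : Set (EuclideanSpace ℝ (Fin d)), MeasurableSet B → 0 ∉ closure B →
    μ (frontier B) = 0 →
    Tendsto (fun t : ℝ => P {w | t⁻¹ • X w ∈ B} / P {w | t < ‖X w‖}) atTop (𝓝 (μ B))

/-- The limit model: `μ` restricted to the complement of the closed unit ball. -/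
def limitModel {d : ℕ} (μ : Measure (EuclideanSpace ℝ (Fin d))) :
    Measure (EuclideanSpace ℝ (Fin d)) :=
  μ.restrict {x | 1 < ‖x‖}

/-- The rescaled vector `θ(x) = ω(x) x`. -/
def rescale {d : ℕ} (ω : EuclideanSpace ℝ (Fin d) → ℝ) (x : EuclideanSpace ℝ (Fin d)) :
    EuclideanSpace ℝ (Fin d) :=
  ω x • x

/-- The scaling function is asymptotically homogeneous of order `-1` and continuous, in the sense
that `t ω(t y) → ω(x)` as `t → ∞` and `y → x`, for almost all `x` in the limit model. Every `ω` that
is homogeneous of order `-1` on `ℝ^d \ {0}` and continuous almost everywhere with respect to `μ`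
has this property. -/
def AsymptoticallyHomogeneous {d : ℕ} (ω : EuclideanSpace ℝ (Fin d) → ℝ)
    (μ : Measure (EuclideanSpace ℝ (Fin d))) : Prop :=
  ∀ᵐ x ∂(limitModel μ),
    Tendsto (fun p : ℝ × EuclideanSpace ℝ (Fin d) => p.1 * ω (p.1 • p.2))
      (atTop ×ˢ 𝓝 x) (𝓝 (ω x))

/-- The matrix of conditional mixed moments `E(Θ Θᵀ | ‖X‖ > t)`, where `Θ = ω(X) X`. -/
def condMoment {Ω : Type*} [MeasurableSpace Ω] {d : ℕ} (P : Measure Ω)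
    (ω : EuclideanSpace ℝ (Fin d) → ℝ) (X : Ω → EuclideanSpace ℝ (Fin d)) (t : ℝ) :
    Matrix (Fin d) (Fin d) ℝ :=
  Matrix.of fun i j => ∫ w, rescale ω (X w) i * rescale ω (X w) j ∂(P[|{w | t < ‖X w‖}])

/-- The `(1 - k/n)`-quantile of `R = ‖X‖`. -/
def tailQuantile {Ω : Type*} [MeasurableSpace Ω] {d : ℕ} (P : Measure Ω)
    (X : Ω → EuclideanSpace ℝ (Fin d)) (n k : ℕ) : ℝ :=
  sInf {r : ℝ | 1 - (k : ℝ) / n ≤ P.real {w | ‖X w‖ ≤ r}}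

/-- The `(k+1)`-th largest of the numbers `r 0, …, r (n-1)` (and `0` if `n ≤ k`). -/
def upperOrderStat (n k : ℕ) (r : Fin n → ℝ) : ℝ :=
  if h : k < n then r (Tuple.sort r ⟨n - 1 - k, by omega⟩) else 0

/-- The empirical threshold: the `(k+1)`-th largest of the norms of the first `n` observations. -/
def empThreshold {Ω : Type*} {d : ℕ} (X : ℕ → Ω → EuclideanSpace ℝ (Fin d)) (n k : ℕ) (w : Ω) : ℝ :=
  upperOrderStat n k fun i => ‖X i w‖

/-- The empirical mixed-moment matrix `k⁻¹ ∑ Θ_i Θ_iᵀ 1{R_i > threshold}` over the first `n`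
observations. -/
def empMoment {Ω : Type*} {d : ℕ} (ω : EuclideanSpace ℝ (Fin d) → ℝ)
    (X : ℕ → Ω → EuclideanSpace ℝ (Fin d)) (n k : ℕ) (w : Ω) : Matrix (Fin d) (Fin d) ℝ :=
  (k : ℝ)⁻¹ • ∑ i : Fin n,
    Set.indicator {v : Ω | empThreshold X n k v < ‖X i v‖}
      (fun v => Matrix.of fun a b => rescale ω (X i v) a * rescale ω (X i v) b) w

/-- The operator norm of a matrix with respect to the Euclidean norm. -/
def opNorm {d : ℕ} (A : Matrix (Fin d) (Fin d) ℝ) : ℝ :=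
  ‖Matrix.toEuclideanCLM (n := Fin d) (𝕜 := ℝ) A‖

/-- The bias condition on the conditional mixed moments: for some `ε > 0`,
`sup_{s ∈ [1-ε, 1+ε]} ‖E(ΘΘᵀ | R > s t_{n,k}) - E(ΘΘᵀ | R > t_{n,k})‖ = o(k^{-1/2})`. -/
def BiasCondition {Ω : Type*} [MeasurableSpace Ω] {d : ℕ} (P : Measure Ω)
    (ω : EuclideanSpace ℝ (Fin d) → ℝ) (X : Ω → EuclideanSpace ℝ (Fin d)) (k : ℕ → ℕ) : Prop :=
  ∃ ε : ℝ, 0 < ε ∧ ∀ δ : ℝ, 0 < δ → ∀ᶠ n in atTop, ∀ s ∈ Set.Icc (1 - ε) (1 + ε),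
    opNorm (condMoment P ω X (s * tailQuantile P X n (k n)) -
      condMoment P ω X (tailQuantile P X n (k n))) ≤ δ * (Real.sqrt (k n))⁻¹

/-- Matrices carry the product sigma-algebra of their entries. -/
instance matrixMeasurableSpace {d : ℕ} : MeasurableSpace (Matrix (Fin d) (Fin d) ℝ) :=
  inferInstanceAs (MeasurableSpace (Fin d → Fin d → ℝ))

instance matrixBorelSpace {d : ℕ} : BorelSpace (Matrix (Fin d) (Fin d) ℝ) :=
  inferInstanceAs (BorelSpace (Fin d → Fin d → ℝ))

end

/-! By Lévy's continuity theorem it suffices to treat one direction `u` at a time. Put v(x) = ∑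
u_{ij} θ_i(x) θ_j(x), let q be the quantile, a = E_q v, and T the empirical threshold. The variable
to study is √k (k⁻¹ ∑ v(X_i) 1{R_i > T} - a).

The central fact is that, given T = s, the k observations above T are i.i.d. with the law of X given
R > s. Up to a small error the characteristic function is therefore an average over the law of T of
φ_s^k, where φ_s = E_s exp(i k^{-1/2} (v - a)). If φ_s^k is close to one number c for every
plausible s, the average is close to c as well, and the randomness of T leaves no trace in the
limit. `norm_integral_prod_top_sub_le` makes this precise without conditional distributions: it sums
over which observation is the threshold and which k lie above it, and applies Fubini to each case.

For s in [(1-ε)q, (1+ε)q], a Taylor expansion gives k(φ_s - 1) = i√k (E_s v - a) - E_s (v - a)²/2 +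
O(k^{-1/2}). The bias condition removes the first term uniformly in s. Regular variation and
asymptotic homogeneity make E_s v, E_s v² and a converge to their values in the limit model
(`tendsto_integral_cond`), so the second term tends to minus half the limiting variance. Hence φ_s^k
→ exp(-Var/2) uniformly in s (`eventually_norm_condCharFun_pow_sub_le`).

That T lies in this window with probability tending to one (`tendsto_upperOrderStat_mem`) follows
from Chebyshev's inequality for the number of exceedances, because the radial tail of `μ` is
multiplicative, larger than 1 at radii below 1 and smaller than 1 above. Continuity of R rules out
ties at T, so that exactly k observations exceed it. `tendsto_integral_exp_empirical` combines these
facts. -/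

/-! ### Upper order statistics and counting -/

/-- Sorting permutes the indices, so exceedances can be counted in the sorted list, where they form
a final segment. This reduces measurability and all probability bounds for the threshold to
counting. -/
theorem lt_upperOrderStat_iff {n k : ℕ} (h : k < n) (r : Fin n → ℝ) (c : ℝ) :
    c < upperOrderStat n k r ↔ k < (Finset.univ.filter fun i => c < r i).card := by
  have hcard : (Finset.univ.filter fun i => c < r i).card
      = (Finset.univ.filter fun i => c < r (Tuple.sort r i)).card := by
    symm
    apply Finset.card_bij (fun i _ => Tuple.sort r i)
    · intro i hi; simpa using hi
    · intro i _ j _ hij; exact (Tuple.sort r).injective hij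
    · intro i hi
      exact ⟨(Tuple.sort r).symm i, by simpa using hi, by simp⟩
  rw [hcard, upperOrderStat, dif_pos h]
  have hmono := Tuple.monotone_sort r
  constructor
  · intro hc
    have hsub : Finset.Ici (⟨n - 1 - k, by omega⟩ : Fin n) ⊆
        Finset.univ.filter fun i => c < r (Tuple.sort r i) := by
      intro i hi
      simp only [Finset.mem_Ici] at hi
      simp only [Finset.mem_filter, Finset.mem_univ, true_and]
      exact hc.trans_le (hmono hi)
    have := Finset.card_le_card hsub
    rw [Fin.card_Ici] at this
    simp only at this
    omega
  · intro hk
    by_contra hc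
    have hsub : (Finset.univ.filter fun i => c < r (Tuple.sort r i)) ⊆
        Finset.Ioi (⟨n - 1 - k, by omega⟩ : Fin n) := by
      intro i hi
      simp only [Finset.mem_filter, Finset.mem_univ, true_and] at hi
      simp only [Finset.mem_Ioi]
      by_contra hle
      exact hc (hi.trans_le (hmono (not_lt.mp hle)))
    have := Finset.card_le_card hsub
    rw [Fin.card_Ioi] at this
    simp only at this
    omega

theorem exists_upperOrderStat_eq {n k : ℕ} (h : k < n) (r : Fin n → ℝ) :
    ∃ j, upperOrderStat n k r = r j :=
  ⟨_, by rw [upperOrderStat, dif_pos h]⟩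

theorem card_gt_upperOrderStat_le {n k : ℕ} (h : k < n) (r : Fin n → ℝ) :
    (Finset.univ.filter fun i => upperOrderStat n k r < r i).card ≤ k := by
  by_contra hc
  exact lt_irrefl _ ((lt_upperOrderStat_iff h r _).2 (not_le.mp hc))

theorem lt_card_ge_upperOrderStat {n k : ℕ} (h : k < n) (r : Fin n → ℝ) :
    k < (Finset.univ.filter fun i => upperOrderStat n k r ≤ r i).card := by
  classical
  set T := upperOrderStat n k r with hT
  -- A level `c` just below `T` lies above every value smaller than `T`; hence exceeding `c` forces
  -- a value to be at least `T`.
  have hev : ∀ᶠ c in 𝓝[<] T, ∀ i, r i < T → r i < c := by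
    rw [eventually_all]
    intro i
    by_cases hi : r i < T
    · filter_upwards [Ioo_mem_nhdsLT hi] with c hc _ using hc.1
    · exact Eventually.of_forall fun c h => absurd h hi
  obtain ⟨c, hc, hcT⟩ := (hev.and self_mem_nhdsWithin).exists
  refine ((lt_upperOrderStat_iff h r c).1 hcT).trans_le (Finset.card_le_card ?_)
  intro i hi
  simp only [Finset.mem_filter, Finset.mem_univ, true_and] at hi ⊢
  by_contra hn
  exact lt_asymm hi (hc i (not_le.mp hn))

theorem upperOrderStat_eq_of_card {n k : ℕ} (h : k < n) (r : Fin n → ℝ) (j : Fin n)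
    (hj : (Finset.univ.filter fun i => r j < r i).card = k) : upperOrderStat n k r = r j := by
  classical
  apply le_antisymm
  · by_contra hc
    exact absurd ((lt_upperOrderStat_iff h r _).1 (not_le.mp hc)) (by omega)
  · by_contra hc
    have h1 := card_gt_upperOrderStat_le h r
    have hsub : insert j (Finset.univ.filter fun i => r j < r i) ⊆
        Finset.univ.filter fun i => upperOrderStat n k r < r i := by
      intro i hi
      simp only [Finset.mem_insert, Finset.mem_filter, Finset.mem_univ, true_and] at hi ⊢
      rcases hi with rfl | hi
      · exact not_le.mp hc
      · exact (not_le.mp hc).trans hi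
    have := Finset.card_le_card hsub
    rw [Finset.card_insert_of_notMem (by simp)] at this
    omega

/-- At most `k` values lie strictly above the order statistic and more than `k` lie weakly above it;
without a tie the two counts differ by one. -/
theorem card_gt_upperOrderStat_eq {n k : ℕ} (h : k < n) (r : Fin n → ℝ) (j : Fin n)
    (hj : upperOrderStat n k r = r j) (huniq : ∀ i, i ≠ j → r i ≠ r j) :
    (Finset.univ.filter fun i => r j < r i).card = k := by
  classical
  apply le_antisymm
  · simpa [hj] using card_gt_upperOrderStat_le h r
  · have h1 := lt_card_ge_upperOrderStat h r
    rw [hj] at h1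
    have hsub : (Finset.univ.filter fun i => r j ≤ r i) ⊆
        insert j (Finset.univ.filter fun i => r j < r i) := by
      intro i hi
      simp only [Finset.mem_insert, Finset.mem_filter, Finset.mem_univ, true_and] at hi ⊢
      by_cases hij : i = j
      · exact Or.inl hij
      · exact Or.inr (lt_of_le_of_ne hi (huniq i hij).symm)
    have := Finset.card_le_card hsub
    rw [Finset.card_insert_of_notMem (by simp)] at this
    omega

theorem measurable_upperOrderStat (n k : ℕ) : Measurable (upperOrderStat n k) := by
  classical
  by_cases h : k < n
  · apply measurable_of_Ioi
    intro c
    have hset : upperOrderStat n k ⁻¹' Set.Ioi c =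
        {r | k < ∑ i, if c < r i then 1 else 0} := by
      ext r
      simp [lt_upperOrderStat_iff h]
    rw [hset]
    refine measurableSet_lt measurable_const (Finset.measurable_fun_sum _ fun i _ => ?_)
    exact Measurable.ite (measurableSet_lt measurable_const (measurable_pi_apply i))
      measurable_const measurable_const
  · have : upperOrderStat n k = fun _ => 0 := by
      funext r; rw [upperOrderStat, dif_neg h]
    rw [this]
    exact measurable_const

/-! ### Splitting the sample space by the threshold observation and the exceedances -/

/-- The event that the `j`-th coordinate has `R`-value in `I`, that the coordinates in `S` (counted
among the remaining ones) have a larger `R`-value and all others a smaller one. -/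
def topEvent {E : Type*} {m : ℕ} (R : E → ℝ) (I : Set ℝ) (j : Fin (m + 1)) (S : Finset (Fin m)) :
    Set (Fin (m + 1) → E) :=
  {x | R (x j) ∈ I ∧ ∀ i, if i ∈ S then R (x j) < R (x (j.succAbove i))
    else R (x (j.succAbove i)) < R (x j)}

section TopEvent

variable {E : Type*} {m : ℕ} {R : E → ℝ} {I : Set ℝ}

theorem filter_lt_of_mem_topEvent {j : Fin (m + 1)} {S : Finset (Fin m)} {x : Fin (m + 1) → E}
    (hx : x ∈ topEvent R I j S) :
    (Finset.univ.filter fun i => R (x j) < R (x i)) = S.map j.succAboveEmb := by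
  ext i
  simp only [Finset.mem_filter, Finset.mem_univ, true_and, Finset.mem_map]
  constructor
  · intro hi
    have hij : i ≠ j := by rintro rfl; exact lt_irrefl _ hi
    obtain ⟨l, rfl⟩ := Fin.exists_succAbove_eq hij
    refine ⟨l, ?_, rfl⟩
    by_contra hl
    have := hx.2 l
    rw [if_neg hl] at this
    exact lt_asymm this hi
  · rintro ⟨l, hl, rfl⟩
    have := hx.2 l
    rwa [if_pos hl] at this

theorem upperOrderStat_of_mem_topEvent {j : Fin (m + 1)} {S : Finset (Fin m)}
    {x : Fin (m + 1) → E} (hx : x ∈ topEvent R I j S) :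
    upperOrderStat (m + 1) S.card (fun i => R (x i)) = R (x j) := by
  have hlt : S.card < m + 1 := Nat.lt_succ_of_le (by simpa using Finset.card_le_univ S)
  apply upperOrderStat_eq_of_card hlt (fun i => R (x i)) j
  rw [filter_lt_of_mem_topEvent hx, Finset.card_map]

theorem exists_mem_topEvent {k : ℕ} (hk : k < m + 1) {x : Fin (m + 1) → E}
    (hT : upperOrderStat (m + 1) k (fun i => R (x i)) ∈ I)
    (hties : ∀ i j, i ≠ j → R (x i) = R (x j) →
      R (x j) ≠ upperOrderStat (m + 1) k fun i => R (x i)) :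
    ∃ j, ∃ S : Finset (Fin m), S.card = k ∧ x ∈ topEvent R I j S := by
  classical
  obtain ⟨j, hj⟩ := exists_upperOrderStat_eq hk (fun i => R (x i))
  have huniq : ∀ i, i ≠ j → R (x i) ≠ R (x j) := fun i hij he => hties i j hij he hj.symm
  have hc := card_gt_upperOrderStat_eq hk (fun i => R (x i)) j hj huniq
  have hmem : x ∈ topEvent R I j
      (Finset.univ.filter fun i => R (x j) < R (x (j.succAbove i))) := by
    refine ⟨hj ▸ hT, fun i => ?_⟩
    by_cases hi : R (x j) < R (x (j.succAbove i))
    · simp [hi]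
    · simpa [hi] using lt_of_le_of_ne (not_lt.mp hi) (huniq _ (Fin.succAbove_ne j i))
  refine ⟨j, _, ?_, hmem⟩
  rw [filter_lt_of_mem_topEvent hmem, Finset.card_map] at hc
  exact hc

/-- Equal cardinalities give the same order statistic, hence the same pivot value; all other
coordinates differ strictly from the pivot, so the pivot is determined, and with it the set above
it. This provides the disjointness needed to sum over events. -/
theorem topEvent_injective {j j' : Fin (m + 1)} {S S' : Finset (Fin m)} {x : Fin (m + 1) → E}
    (hS : S.card = S'.card) (hx : x ∈ topEvent R I j S) (hx' : x ∈ topEvent R I j' S') :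
    j = j' ∧ S = S' := by
  have hT := upperOrderStat_of_mem_topEvent hx
  rw [hS, upperOrderStat_of_mem_topEvent hx'] at hT
  have hj : j = j' := by
    by_contra hne
    obtain ⟨l, rfl⟩ := Fin.exists_succAbove_eq (Ne.symm hne)
    have := hx.2 l
    split_ifs at this
    · exact this.ne' hT
    · exact this.ne hT
  subst hj
  refine ⟨rfl, ?_⟩
  have h1 := filter_lt_of_mem_topEvent hx
  rw [filter_lt_of_mem_topEvent hx'] at h1
  exact (Finset.map_injective _ h1).symm

variable [MeasurableSpace E]

theorem measurableSet_topEvent (hR : Measurable R) (hI : MeasurableSet I)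
    (j : Fin (m + 1)) (S : Finset (Fin m)) : MeasurableSet (topEvent R I j S) := by
  have hRi : ∀ i : Fin (m + 1), Measurable fun x : Fin (m + 1) → E => R (x i) := fun i =>
    hR.comp (measurable_pi_apply i)
  have : topEvent R I j S = {x : Fin (m + 1) → E | R (x j) ∈ I} ∩
      ⋂ i, {x | if i ∈ S then R (x j) < R (x (j.succAbove i))
        else R (x (j.succAbove i)) < R (x j)} := by
    ext x; simp [topEvent]
  rw [this]
  refine ((hRi j) hI).inter (MeasurableSet.iInter fun i => ?_)
  by_cases hi : i ∈ S
  · simpa [hi] using measurableSet_lt (hRi j) (hRi _)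
  · simpa [hi] using measurableSet_lt (hRi _) (hRi j)

/-- Fubini with the pivot coordinate integrated last: once its value is fixed, the other coordinates
are independent and restricted to one side of it. This replaces conditioning on the threshold. -/
theorem setIntegral_topEvent (L : Measure E) [IsProbabilityMeasure L] (hR : Measurable R)
    (hI : MeasurableSet I) {g : E → ℂ} (hg : Measurable g) (hg1 : ∀ x, ‖g x‖ ≤ 1)
    (j : Fin (m + 1)) (S : Finset (Fin m)) :
    Integrable (fun y => (R ⁻¹' I).indicator (fun y => (∫ z in {z | R y < R z}, g z ∂L) ^ S.card *
        (L.real {z | R z < R y} : ℂ) ^ (m - S.card)) y) L ∧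
    ∫ x in topEvent R I j S, ∏ i ∈ S, g (x (j.succAbove i)) ∂(Measure.pi fun _ => L) =
      ∫ y, (R ⁻¹' I).indicator (fun y => (∫ z in {z | R y < R z}, g z ∂L) ^ S.card *
        (L.real {z | R z < R y} : ℂ) ^ (m - S.card)) y ∂L := by
  classical
  -- For a fixed pivot `y`, the integrand with its indicator is a product of one function per
  -- remaining coordinate.
  set h : E → Fin m → E → ℂ := fun y i z =>
    if i ∈ S then {z | R y < R z}.indicator g z else {z | R z < R y}.indicator 1 z with hh
  set F : E × (Fin m → E) → ℂ := fun p =>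
    (R ⁻¹' I).indicator (fun _ => ∏ i, h p.1 i (p.2 i)) p.1 with hF
  have hFx : ∀ x : Fin (m + 1) → E, (topEvent R I j S).indicator
      (fun x => ∏ i ∈ S, g (x (j.succAbove i))) x =
      F (MeasurableEquiv.piFinSuccAbove (fun _ => E) j x) := by
    intro x
    have hx1 : (MeasurableEquiv.piFinSuccAbove (fun _ => E) j x).1 = x j := rfl
    have hx2 : ∀ i, (MeasurableEquiv.piFinSuccAbove (fun _ => E) j x).2 i = x (j.succAbove i) :=
      fun _ => rfl
    simp only [hF, hx1, hx2]
    by_cases hxI : R (x j) ∈ I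
    · rw [Set.indicator_of_mem (show x j ∈ R ⁻¹' I from hxI)]
      by_cases hx : x ∈ topEvent R I j S
      · rw [Set.indicator_of_mem hx, ← Finset.prod_subset (Finset.subset_univ S)]
        · refine Finset.prod_congr rfl fun i hi => ?_
          have := hx.2 i
          simp only [hi, if_true] at this
          simp [hh, hi, this]
        · intro i _ hi
          have := hx.2 i
          simp only [hi, if_false] at this
          simp [hh, hi, this]
      · rw [Set.indicator_of_notMem hx]
        have : ∃ i, ¬ (if i ∈ S then R (x j) < R (x (j.succAbove i))
            else R (x (j.succAbove i)) < R (x j)) := by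
          by_contra hcon
          push Not at hcon
          exact hx ⟨hxI, hcon⟩
        obtain ⟨i, hi⟩ := this
        symm
        apply Finset.prod_eq_zero (Finset.mem_univ i)
        by_cases hiS : i ∈ S
        · simp only [hiS, if_true] at hi
          simp [hh, hiS, hi]
        · simp only [hiS, if_false] at hi
          simp [hh, hiS, hi]
    · rw [Set.indicator_of_notMem (show x j ∉ R ⁻¹' I from hxI),
        Set.indicator_of_notMem fun hx => hxI hx.1]
  have hFm : Measurable F := by
    have hRy : Measurable fun p : E × (Fin m → E) => R p.1 := hR.comp measurable_fst
    have : ∀ i, Measurable fun p : E × (Fin m → E) => h p.1 i (p.2 i) := by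
      intro i
      have hz : Measurable fun p : E × (Fin m → E) => p.2 i :=
        (measurable_pi_apply i).comp measurable_snd
      by_cases hi : i ∈ S
      · simp only [hh, hi, if_true, Set.indicator_apply]
        exact Measurable.ite (measurableSet_lt hRy (hR.comp hz)) (hg.comp hz) measurable_const
      · simp only [hh, hi, if_false, Set.indicator_apply]
        exact Measurable.ite (measurableSet_lt (hR.comp hz) hRy) measurable_const measurable_const
    simp only [hF, Set.indicator_apply]
    exact Measurable.ite ((hR.comp measurable_fst) hI)
      (Finset.measurable_prod _ fun i _ => this i) measurable_const
  have hFb : ∀ p, ‖F p‖ ≤ 1 := by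
    intro p
    refine (norm_indicator_le_norm_self _ _).trans ?_
    rw [norm_prod]
    refine Finset.prod_le_one (fun _ _ => norm_nonneg _) fun i _ => ?_
    by_cases hi : i ∈ S
    · simp only [hh, hi, if_true]
      exact (norm_indicator_le_norm_self _ _).trans (hg1 _)
    · simp only [hh, hi, if_false]
      exact (norm_indicator_le_norm_self _ _).trans (by simp)
  have hFi : Integrable F (L.prod (Measure.pi fun _ => L)) :=
    Integrable.of_bound hFm.aestronglyMeasurable 1 (Eventually.of_forall hFb)
  have hinner : ∀ y, ∫ q, F (y, q) ∂(Measure.pi fun _ : Fin m => L) =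
      (R ⁻¹' I).indicator (fun y => (∫ z in {z | R y < R z}, g z ∂L) ^ S.card *
        (L.real {z | R z < R y} : ℂ) ^ (m - S.card)) y := by
    intro y
    by_cases hy : R y ∈ I
    · have hy' : y ∈ R ⁻¹' I := hy
      simp only [hF, Set.indicator_of_mem hy']
      rw [integral_fintype_prod_eq_prod (fun i z => h y i z)]
      have h1 : ∀ i, ∫ z, h y i z ∂L = if i ∈ S then ∫ z in {z | R y < R z}, g z ∂L
          else (L.real {z | R z < R y} : ℂ) := by
        intro i
        by_cases hi : i ∈ S
        · simp only [hh, hi, if_true]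
          rw [integral_indicator (measurableSet_lt measurable_const hR)]
        · simp only [hh, hi, if_false]
          rw [integral_indicator (measurableSet_lt hR measurable_const)]
          simp
      simp only [h1]
      rw [Finset.prod_ite, Finset.prod_const, Finset.prod_const]
      congr 2
      · simp
      · rw [Finset.filter_not, Finset.card_sdiff_of_subset (Finset.filter_subset _ _)]
        simp
    · have hy' : y ∉ R ⁻¹' I := hy
      simp only [hF, Set.indicator_of_notMem hy', integral_zero]
  constructor
  · exact hFi.integral_prod_left.congr (Eventually.of_forall hinner)
  · rw [← integral_indicator (measurableSet_topEvent hR hI j S)]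
    simp only [hFx]
    rw [(measurePreserving_piFinSuccAbove (fun _ => L) j).integral_comp' (g := F),
      integral_prod F hFi]
    exact integral_congr_ae (Eventually.of_forall hinner)

/-- The Fubini formulas for `g` and for the constant 1 share the factor of the observations below
the pivot, so `H` can be applied pointwise at `s = R y`. -/
theorem norm_setIntegral_topEvent_sub_le (L : Measure E) [IsProbabilityMeasure L]
    (hR : Measurable R) (hI : MeasurableSet I) {g : E → ℂ} (hg : Measurable g)
    (hg1 : ∀ x, ‖g x‖ ≤ 1) {k : ℕ} {c : ℂ} {η : ℝ}
    (H : ∀ s ∈ I, ‖(∫ z in {z | s < R z}, g z ∂L) ^ k - c * (L.real {z | s < R z} : ℂ) ^ k‖ ≤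
      η * L.real {z | s < R z} ^ k)
    (j : Fin (m + 1)) (S : Finset (Fin m)) (hS : S.card = k) :
    ‖∫ x in topEvent R I j S, (∏ i ∈ S, g (x (j.succAbove i)) - c) ∂(Measure.pi fun _ => L)‖ ≤
      η * (Measure.pi fun _ => L).real (topEvent R I j S) := by
  obtain ⟨hi1, he1⟩ := setIntegral_topEvent L hR hI hg hg1 j S
  obtain ⟨hi2, he2⟩ := setIntegral_topEvent L hR hI (g := fun _ => 1) measurable_const
    (by simp) j S
  simp only [Finset.prod_const_one, integral_const, MeasurableSet.univ, measureReal_restrict_apply,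
    Set.univ_inter, Complex.real_smul, mul_one, hS] at hi1 he1 hi2 he2
  have hprod : Integrable (fun x : Fin (m + 1) → E => ∏ i ∈ S, g (x (j.succAbove i)))
      (Measure.pi fun _ => L) := by
    refine Integrable.of_bound (C := 1) (Finset.measurable_prod _ fun i _ =>
      hg.comp (measurable_pi_apply _)).aestronglyMeasurable (Eventually.of_forall fun x => ?_)
    rw [norm_prod]
    exact Finset.prod_le_one (fun _ _ => norm_nonneg _) fun i _ => hg1 _
  rw [integral_sub hprod.integrableOn (integrable_const c), he1, setIntegral_const,
    Complex.real_smul, he2, mul_comm _ c, ← integral_const_mul, ← integral_sub hi1 (hi2.const_mul c)]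
  -- The case `g = 1` writes the probability of the event as an integral over the pivot, which is
  -- the required dominating function.
  have hre : η * (Measure.pi fun _ => L).real (topEvent R I j S) =
      ∫ y, η * ((R ⁻¹' I).indicator (fun y => L.real {z | R y < R z} ^ k *
        L.real {z | R z < R y} ^ (m - k)) y) ∂L := by
    rw [integral_const_mul]
    congr 1
    apply Complex.ofReal_injective
    rw [he2, ← integral_complex_ofReal]
    refine integral_congr_ae (Eventually.of_forall fun y => ?_)
    by_cases hy : y ∈ R ⁻¹' I
    · simp [Set.indicator_of_mem hy]
    · simp [Set.indicator_of_notMem hy]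
  rw [hre]
  refine norm_integral_le_of_norm_le ?_ (Eventually.of_forall fun y => ?_)
  · refine Integrable.const_mul ?_ η
    refine hi2.re.congr (Eventually.of_forall fun y => ?_)
    by_cases hy : y ∈ R ⁻¹' I
    · simp only [Set.indicator_of_mem hy]
      norm_cast
    · simp [Set.indicator_of_notMem hy]
  · by_cases hy : y ∈ R ⁻¹' I
    · simp only [Set.indicator_of_mem hy]
      rw [← mul_assoc, ← sub_mul, norm_mul, ← mul_assoc]
      have : ‖(L.real {z | R z < R y} : ℂ) ^ (m - k)‖ = L.real {z | R z < R y} ^ (m - k) := by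
        rw [norm_pow, Complex.norm_real, Real.norm_of_nonneg measureReal_nonneg]
      rw [this]
      exact mul_le_mul_of_nonneg_right (H _ hy) (by positivity)
    · simp [Set.indicator_of_notMem hy]

/-- If, for every threshold `s ∈ I`, the `k`-th power of the mean of `g` given `R > s` is within `η`
of `c`, then the mean of the product of `g` over the `k` largest observations is close to `c`. -/
theorem norm_integral_prod_top_sub_le (L : Measure E) [IsProbabilityMeasure L]
    (hR : Measurable R) (hI : MeasurableSet I) {g : E → ℂ} (hg : Measurable g)
    (hg1 : ∀ x, ‖g x‖ ≤ 1) {n k : ℕ} (hkn : k < n) {c : ℂ} (hc : ‖c‖ ≤ 1) {η : ℝ} (hη : 0 ≤ η)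
    (H : ∀ s ∈ I, ‖(∫ z in {z | s < R z}, g z ∂L) ^ k - c * (L.real {z | s < R z} : ℂ) ^ k‖ ≤
      η * L.real {z | s < R z} ^ k) {N : Set (Fin n → E)}
    (hN : ∀ x ∉ N, upperOrderStat n k (fun i => R (x i)) ∈ I ∧ ∀ i j, i ≠ j → R (x i) = R (x j) →
      R (x j) ≠ upperOrderStat n k fun i => R (x i)) :
    ‖∫ x, (∏ i, if upperOrderStat n k (fun i => R (x i)) < R (x i) then g (x i) else 1)
      ∂(Measure.pi fun _ => L) - c‖ ≤ η + 2 * (Measure.pi fun _ => L).real N := by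
  classical
  obtain ⟨m, rfl⟩ : ∃ m, n = m + 1 := ⟨n - 1, by omega⟩
  set W : (Fin (m + 1) → E) → ℂ := fun x =>
    ∏ i, if upperOrderStat (m + 1) k (fun i => R (x i)) < R (x i) then g (x i) else 1 with hW
  set Q : Measure (Fin (m + 1) → E) := Measure.pi fun _ => L with hQ
  have hWm : Measurable W := by
    refine Finset.measurable_prod _ fun i _ => Measurable.ite (measurableSet_lt
      ((measurable_upperOrderStat _ _).comp (measurable_pi_lambda _ fun i =>
        hR.comp (measurable_pi_apply i))) (hR.comp (measurable_pi_apply i)))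
      (hg.comp (measurable_pi_apply i)) measurable_const
  have hWb : ∀ x, ‖W x‖ ≤ 1 := by
    intro x
    rw [hW, norm_prod]
    refine Finset.prod_le_one (fun _ _ => norm_nonneg _) fun i _ => ?_
    split_ifs
    · exact hg1 _
    · simp
  have hWi : Integrable W Q :=
    Integrable.of_bound hWm.aestronglyMeasurable 1 (Eventually.of_forall hWb)
  have hWci : Integrable (fun x => W x - c) Q := hWi.sub (integrable_const c)
  set J : Finset (Fin (m + 1) × Finset (Fin m)) :=
    Finset.univ ×ˢ Finset.powersetCard k Finset.univ with hJ
  have hJS : ∀ p ∈ J, p.2.card = k := by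
    intro p hp
    exact (Finset.mem_powersetCard.1 (Finset.mem_product.1 hp).2).2
  set A : Fin (m + 1) × Finset (Fin m) → Set (Fin (m + 1) → E) := fun p =>
    topEvent R I p.1 p.2 with hA
  have hAm : ∀ p, MeasurableSet (A p) := fun p => measurableSet_topEvent hR hI _ _
  -- These disjoint events cover everything outside `N`. On them the errors add up to at most `η`;
  -- on the remainder the integrand is bounded by 2.
  set B := ⋃ p ∈ J, A p with hB
  have hBm : MeasurableSet B := Finset.measurableSet_biUnion _ fun p _ => hAm p
  have hdisj : (J : Set _).PairwiseDisjoint A := by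
    intro p hp q hq hpq
    rw [Function.onFun, Set.disjoint_left]
    intro x hxp hxq
    obtain ⟨h1, h2⟩ := topEvent_injective ((hJS p hp).trans (hJS q hq).symm) hxp hxq
    exact hpq (Prod.ext h1 h2)
  have hBc : Bᶜ ⊆ N := by
    intro x hx
    by_contra hxN
    obtain ⟨j, S, hS, hmem⟩ := exists_mem_topEvent hkn (hN x hxN).1 (hN x hxN).2
    refine hx (Set.mem_iUnion₂.2 ⟨(j, S), ?_, hmem⟩)
    simp [hJ, hS]
  have hsub : ∫ x, W x ∂Q - c = ∫ x, (W x - c) ∂Q := by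
    rw [integral_sub hWi (integrable_const c)]
    simp
  rw [hsub, ← integral_add_compl hBm hWci]
  refine (norm_add_le _ _).trans (add_le_add ?_ ?_)
  · rw [hB, integral_biUnion_finset J (fun p _ => hAm p) hdisj fun p _ => hWci.integrableOn]
    calc ‖∑ p ∈ J, ∫ x in A p, (W x - c) ∂Q‖ ≤ ∑ p ∈ J, ‖∫ x in A p, (W x - c) ∂Q‖ :=
          norm_sum_le _ _
      _ ≤ ∑ p ∈ J, η * Q.real (A p) := by
          refine Finset.sum_le_sum fun p hp => ?_
          have : ∫ x in A p, (W x - c) ∂Q =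
              ∫ x in A p, (∏ i ∈ p.2, g (x (p.1.succAbove i)) - c) ∂Q := by
            refine setIntegral_congr_fun (hAm p) fun x hx => ?_
            have hT := upperOrderStat_of_mem_topEvent hx
            rw [hJS p hp] at hT
            simp only [hW, hT]
            rw [← Finset.prod_filter, filter_lt_of_mem_topEvent hx, Finset.prod_map]
            rfl
          rw [this]
          exact norm_setIntegral_topEvent_sub_le L hR hI hg hg1 H p.1 p.2 (hJS p hp)
      _ = η * Q.real B := by
          rw [← Finset.mul_sum, hB, measureReal_biUnion_finset hdisj fun p _ => hAm p]
      _ ≤ η * 1 := mul_le_mul_of_nonneg_left measureReal_le_one hη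
      _ = η := mul_one η
  · calc ‖∫ x in Bᶜ, (W x - c) ∂Q‖ ≤ 2 * Q.real Bᶜ := by
          refine norm_setIntegral_le_of_norm_le_const (measure_lt_top _ _) fun x _ => ?_
          refine (norm_sub_le _ _).trans ?_
          linarith [hWb x]
      _ ≤ 2 * Q.real N := by
          have := measureReal_mono (μ := Q) hBc
          linarith

end TopEvent

/-! ### Absence of ties and deviation of exceedance counts -/

section Threshold

variable {E : Type*} [MeasurableSpace E] {R : E → ℝ}

/-- For each of the finitely many pairs, fixing coordinate `j` forces another independent coordinate
onto a null level set of `R`; Fubini concludes. -/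
theorem measure_pi_ties_eq_zero (L : Measure E) [IsProbabilityMeasure L] (hR : Measurable R)
    {r₀ : ℝ} (hL : ∀ r, r₀ ≤ r → L {x | R x = r} = 0) (n : ℕ) :
    (Measure.pi fun _ : Fin n => L) {x | ∃ i j, i ≠ j ∧ R (x i) = R (x j) ∧ r₀ ≤ R (x j)} = 0 := by
  have hset : {x : Fin n → E | ∃ i j, i ≠ j ∧ R (x i) = R (x j) ∧ r₀ ≤ R (x j)} =
      ⋃ i, ⋃ j, {x | i ≠ j ∧ R (x i) = R (x j) ∧ r₀ ≤ R (x j)} := by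
    ext x; simp
  rw [hset, measure_iUnion_null_iff]
  intro i
  rw [measure_iUnion_null_iff]
  intro j
  by_cases hij : i = j
  · simp [hij]
  obtain ⟨m, rfl⟩ : ∃ m, n = m + 1 := ⟨n - 1, by have := j.2; omega⟩
  obtain ⟨l, rfl⟩ := Fin.exists_succAbove_eq hij
  have hmp := measurePreserving_piFinSuccAbove (fun _ : Fin (m + 1) => L) j
  have hm : MeasurableSet {p : E × (Fin m → E) | R (p.2 l) = R p.1 ∧ r₀ ≤ R p.1} := by
    refine (measurableSet_eq_fun (hR.comp ((measurable_pi_apply l).comp measurable_snd))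
      (hR.comp measurable_fst)).inter (measurableSet_le measurable_const (hR.comp measurable_fst))
  have hpre : {x : Fin (m + 1) → E |
      j.succAbove l ≠ j ∧ R (x (j.succAbove l)) = R (x j) ∧ r₀ ≤ R (x j)} =
      MeasurableEquiv.piFinSuccAbove (fun _ => E) j ⁻¹'
        {p : E × (Fin m → E) | R (p.2 l) = R p.1 ∧ r₀ ≤ R p.1} := by
    ext x
    simp only [ne_eq, hij, not_false_eq_true, true_and]
    rfl
  rw [hpre, hmp.measure_preimage hm.nullMeasurableSet, Measure.measure_prod_null hm]
  refine Eventually.of_forall fun y => ?_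
  by_cases hy : r₀ ≤ R y
  · refine measure_mono_null (t := Function.eval l ⁻¹' {z | R z = R y}) (fun q hq => hq.1) ?_
    rw [(measurePreserving_eval (fun _ : Fin m => L) l).measure_preimage
      (measurableSet_eq_fun hR measurable_const).nullMeasurableSet]
    exact hL _ hy
  · have : Prod.mk y ⁻¹' {p : E × (Fin m → E) | R (p.2 l) = R p.1 ∧ r₀ ≤ R p.1} = ∅ := by
      ext q; simp [hy]
    simp [this]

/-- Chebyshev's inequality for a binomial count, whose variance is at most its mean. -/
theorem measureReal_card_deviation_le (L : Measure E) [IsProbabilityMeasure L]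
    (hR : Measurable R) (n : ℕ) (c : ℝ) {a : ℝ} (ha : 0 < a) :
    (Measure.pi fun _ : Fin n => L).real
      {x | a ≤ |((Finset.univ.filter fun i => c < R (x i)).card : ℝ) -
        n * L.real {y | c < R y}|} ≤ n * L.real {y | c < R y} / a ^ 2 := by
  classical
  set A : Set E := {y | c < R y} with hA
  have hAm : MeasurableSet A := measurableSet_lt measurable_const hR
  set Y : E → ℝ := A.indicator 1 with hY
  have hYm : Measurable Y := measurable_one.indicator hAm
  have hYL : MemLp Y 2 L := MemLp.of_bound hYm.aestronglyMeasurable 1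
    (Eventually.of_forall fun y => (norm_indicator_le_norm_self _ _).trans (by simp))
  set Q := Measure.pi fun _ : Fin n => L with hQ
  have hcard : ∀ x : Fin n → E, ((Finset.univ.filter fun i => c < R (x i)).card : ℝ) =
      (∑ i, fun x : Fin n → E => Y (x i)) x := by
    intro x
    rw [Finset.sum_apply, Finset.card_filter]
    push_cast
    exact Finset.sum_congr rfl fun i _ => by simp [hY, hA, Set.indicator_apply]
  have hYi : ∀ i, MemLp (fun x : Fin n → E => Y (x i)) 2 Q := fun i =>
    hYL.comp_measurePreserving (measurePreserving_eval (fun _ : Fin n => L) i)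
  have hS : MemLp (∑ i, fun x : Fin n → E => Y (x i)) 2 Q := memLp_finsetSum' _ fun i _ => hYi i
  have hEY : ∫ y, Y y ∂L = L.real A := integral_indicator_one hAm
  have hE : Q[∑ i, fun x : Fin n → E => Y (x i)] = n * L.real A := by
    simp only [Finset.sum_apply]
    rw [integral_finsetSum _ fun i _ => (hYi i).integrable one_le_two]
    have : ∀ i : Fin n, ∫ x, Y (x i) ∂Q = L.real A := fun i => by
      rw [← hEY]
      exact integral_comp_eval (μ := fun _ : Fin n => L) (i := i) hYm.aestronglyMeasurable
    simp [this]
  have hV : Var[∑ i, fun x : Fin n → E => Y (x i); Q] ≤ n * L.real A := by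
    rw [hQ, variance_sum_pi fun _ => hYL]
    simp only [Finset.sum_const, Finset.card_univ, Fintype.card_fin, nsmul_eq_mul]
    refine mul_le_mul_of_nonneg_left ?_ (Nat.cast_nonneg n)
    refine (variance_le_expectation_sq hYm.aestronglyMeasurable).trans (le_of_eq ?_)
    rw [← hEY]
    refine integral_congr_ae (Eventually.of_forall fun y => ?_)
    by_cases hy : y ∈ A <;> simp [hY, hy]
  have := meas_ge_le_variance_div_sq hS ha
  rw [hE] at this
  simp only [hcard]
  rw [measureReal_def]
  refine ENNReal.toReal_le_of_le_ofReal (by positivity) (this.trans ?_)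
  exact ENNReal.ofReal_le_ofReal (by gcongr)

theorem measureReal_lt_upperOrderStat_le (L : Measure E) [IsProbabilityMeasure L]
    (hR : Measurable R) {n k : ℕ} (hkn : k < n) {c : ℝ} (hc : n * L.real {y | c < R y} < k) :
    (Measure.pi fun _ : Fin n => L).real {x | c < upperOrderStat n k fun i => R (x i)} ≤
      n * L.real {y | c < R y} / (k - n * L.real {y | c < R y}) ^ 2 := by
  refine le_trans (measureReal_mono fun x hx => ?_)
    (measureReal_card_deviation_le L hR n c (sub_pos.2 hc))
  replace hx := (lt_upperOrderStat_iff hkn (fun i => R (x i)) c).1 hx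
  have hx' : (k : ℝ) < (Finset.univ.filter fun i => c < R (x i)).card := by exact_mod_cast hx
  rw [Set.mem_ofPred_eq]
  refine le_trans ?_ (le_abs_self _)
  linarith

theorem measureReal_upperOrderStat_le_le (L : Measure E) [IsProbabilityMeasure L]
    (hR : Measurable R) {n k : ℕ} (hkn : k < n) {c : ℝ} (hc : k < n * L.real {y | c < R y}) :
    (Measure.pi fun _ : Fin n => L).real {x | (upperOrderStat n k fun i => R (x i)) ≤ c} ≤
      n * L.real {y | c < R y} / (n * L.real {y | c < R y} - k) ^ 2 := by
  refine le_trans (measureReal_mono fun x hx => ?_)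
    (measureReal_card_deviation_le L hR n c (sub_pos.2 hc))
  replace hx := not_lt.1 (mt (lt_upperOrderStat_iff hkn (fun i => R (x i)) c).2 (not_lt.2 hx))
  have hx' : ((Finset.univ.filter fun i => c < R (x i)).card : ℝ) ≤ k := by exact_mod_cast hx
  rw [Set.mem_ofPred_eq]
  refine le_trans ?_ (neg_le_abs _)
  linarith

end Threshold

/-! ### Radial tails of the limit measure -/

namespace IsRegularlyVarying

variable {d : ℕ} {L μ : Measure (EuclideanSpace ℝ (Fin d))}

theorem measurableSet_norm_gt (a : ℝ) :
    MeasurableSet {x : EuclideanSpace ℝ (Fin d) | a < ‖x‖} :=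
  measurableSet_lt measurable_const measurable_norm

theorem zero_notMem_closure_norm_gt {a : ℝ} (ha : 0 < a) :
    (0 : EuclideanSpace ℝ (Fin d)) ∉ closure {x | a < ‖x‖} := by
  intro h0
  have : closure {x : EuclideanSpace ℝ (Fin d) | a < ‖x‖} ⊆ {x | a ≤ ‖x‖} :=
    closure_minimal (fun x hx => show a ≤ ‖x‖ from le_of_lt (show a < ‖x‖ from hx))
      (isClosed_le continuous_const continuous_norm)
  have h1 : a ≤ ‖(0 : EuclideanSpace ℝ (Fin d))‖ := this h0
  rw [norm_zero] at h1
  linarith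

theorem frontier_norm_gt_subset (a : ℝ) :
    frontier {x : EuclideanSpace ℝ (Fin d) | a < ‖x‖} ⊆ {x | ‖x‖ = a} := by
  intro x hx
  exact (frontier_lt_subset_eq continuous_const continuous_norm hx).symm

theorem measure_norm_gt_lt_top (h : IsRegularlyVarying L id μ) {a : ℝ} (ha : 0 < a) :
    μ {x | a < ‖x‖} < ⊤ :=
  h.finite_away _ (measurableSet_norm_gt a) (zero_notMem_closure_norm_gt ha)

theorem preimage_smul_norm_gt {t : ℝ} (ht : 0 < t) (a : ℝ) :
    {x : EuclideanSpace ℝ (Fin d) | a < ‖t⁻¹ • id x‖} =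
      {x | a * t < ‖x‖} := by
  ext x
  simp only [id, Set.mem_ofPred_eq, norm_smul, norm_inv, Real.norm_of_nonneg ht.le]
  rw [← div_eq_inv_mul, lt_div_iff₀ ht]

/-- Nondegeneracy in usable form: the sets {‖x‖ > 1/(n+1)} exhaust the complement of the origin, so
null tails at arbitrarily small radii would make `μ` vanish. -/
theorem eq_zero_of_norm_gt (h : IsRegularlyVarying L id μ)
    (h0 : ∀ a, 0 < a → ∃ b, b ≤ a ∧ μ {x | b < ‖x‖} = 0) : False := by
  apply h.nondegenerate
  rw [← Measure.measure_univ_eq_zero]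
  have hsub : (Set.univ : Set (EuclideanSpace ℝ (Fin d))) ⊆
      {0} ∪ ⋃ n : ℕ, {x | 1 / ((n : ℝ) + 1) < ‖x‖} := by
    intro x _
    by_cases hx : x = 0
    · exact Or.inl hx
    · obtain ⟨n, hn⟩ := exists_nat_one_div_lt (norm_pos_iff.2 hx)
      exact Or.inr (Set.mem_iUnion.2 ⟨n, hn⟩)
  refine measure_mono_null hsub (measure_union_null h.measure_zero (measure_iUnion_null fun n => ?_))
  obtain ⟨b, hb, hb0⟩ := h0 (1 / ((n : ℝ) + 1)) (by positivity)
  exact measure_mono_null (fun x hx => lt_of_le_of_lt hb hx) hb0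

/-- Distinct spheres are disjoint, and `μ` is finite away from the origin, so only countably many
beyond each radius 1/(n+1) carry mass. Uncharged radii are then dense. -/
theorem countable_charged_spheres (h : IsRegularlyVarying L id μ) :
    {a : ℝ | 0 < a ∧ μ {x | ‖x‖ = a} ≠ 0}.Countable := by
  have hn : ∀ n : ℕ, {a : ℝ | 1 / ((n : ℝ) + 1) < a ∧ μ {x | ‖x‖ = a} ≠ 0}.Countable := by
    intro n
    set b : ℝ := 1 / ((n : ℝ) + 1) with hb
    have hb0 : 0 < b := by positivity
    have : IsFiniteMeasure (μ.restrict {x | b < ‖x‖}) :=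
      ⟨by rw [Measure.restrict_apply_univ]; exact h.measure_norm_gt_lt_top hb0⟩
    have hm : ∀ a : ℝ, MeasurableSet {x : EuclideanSpace ℝ (Fin d) | ‖x‖ = a} := fun a =>
      measurableSet_eq_fun measurable_norm measurable_const
    have key := Measure.countable_meas_pos_of_disjoint_iUnion (μ := μ.restrict {x | b < ‖x‖}) hm
      (by
        intro a a' haa
        rw [Function.onFun, Set.disjoint_left]
        intro x hx hx'
        exact haa (hx.symm.trans hx'))
    refine key.mono fun a ha => ?_
    have : μ.restrict {x | b < ‖x‖} {x | ‖x‖ = a} = μ {x | ‖x‖ = a} := by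
      rw [Measure.restrict_apply (hm a)]
      congr 1
      ext x
      simp only [Set.mem_inter_iff, Set.mem_ofPred_eq, and_iff_left_iff_imp]
      rintro rfl
      exact ha.1
    simpa [this, pos_iff_ne_zero] using ha.2
  refine (Set.countable_iUnion hn).mono ?_
  rintro a ⟨ha, hμ⟩
  obtain ⟨n, hn⟩ := exists_nat_one_div_lt ha
  exact Set.mem_iUnion.2 ⟨n, hn, hμ⟩

theorem tendsto_ratio_ennreal (h : IsRegularlyVarying L id μ) {a : ℝ} (ha : 0 < a)
    (hs : μ {x | ‖x‖ = a} = 0) :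
    Tendsto (fun t : ℝ => L {x | a * t < ‖x‖} / L {x | t < ‖x‖}) atTop (𝓝 (μ {x | a < ‖x‖})) := by
  refine (h.tendsto _ (measurableSet_norm_gt a) (zero_notMem_closure_norm_gt ha)
    (measure_mono_null (frontier_norm_gt_subset a) hs)).congr' ?_
  filter_upwards [eventually_gt_atTop 0] with t ht
  rw [preimage_smul_norm_gt ht]
  rfl

theorem tail_ne_zero (h : IsRegularlyVarying L id μ) (t : ℝ) : L {x | t < ‖x‖} ≠ 0 := by
  intro ht
  refine h.eq_zero_of_norm_gt fun a ha => ?_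
  have hd := h.countable_charged_spheres.dense_compl ℝ
  obtain ⟨b, hb, hbm⟩ := hd.exists_between (half_lt_self ha)
  have hb0 : 0 < b := (half_pos ha).trans hbm.1
  have hbs : μ {x | ‖x‖ = b} = 0 := by
    by_contra hne
    exact hb ⟨hb0, hne⟩
  refine ⟨b, hbm.2.le, ?_⟩
  refine tendsto_nhds_unique (h.tendsto_ratio_ennreal hb0 hbs) (tendsto_const_nhds.congr' ?_)
  -- A vanishing tail makes the numerator eventually zero, and `0 / 0 = 0` in `ENNReal`, so the
  -- limit `μ {x | b < ‖x‖}` is zero.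
  filter_upwards [eventually_ge_atTop (t / b)] with s hs
  have : L {x | b * s < ‖x‖} = 0 := by
    refine measure_mono_null (fun x hx => ?_) ht
    have h1 : t ≤ b * s := by rwa [div_le_iff₀' hb0] at hs
    exact lt_of_le_of_lt h1 hx
  rw [this, ENNReal.zero_div]

theorem tendsto_ratio (h : IsRegularlyVarying L id μ) {a : ℝ} (ha : 0 < a)
    (hs : μ {x | ‖x‖ = a} = 0) :
    Tendsto (fun t : ℝ => L.real {x | a * t < ‖x‖} / L.real {x | t < ‖x‖}) atTop
      (𝓝 (μ.real {x | a < ‖x‖})) := by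
  have := (ENNReal.tendsto_toReal (h.measure_norm_gt_lt_top ha).ne).comp
    (h.tendsto_ratio_ennreal ha hs)
  refine this.congr fun t => ?_
  simp [measureReal_def, ENNReal.toReal_div]

theorem tendsto_measure_norm_gt (h : IsRegularlyVarying L id μ) {a : ℝ} (ha : 0 < a) {u : ℕ → ℝ}
    (hu : StrictAnti u) (hua : ∀ n, a < u n) (hlim : Tendsto u atTop (𝓝 a)) :
    Tendsto (fun n => μ.real {x | u n < ‖x‖}) atTop (𝓝 (μ.real {x | a < ‖x‖})) := by
  have hU : {x : EuclideanSpace ℝ (Fin d) | a < ‖x‖} = ⋃ n, {x | u n < ‖x‖} := by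
    ext x
    simp only [Set.mem_ofPred_eq, Set.mem_iUnion]
    constructor
    · intro hx
      exact (hlim.eventually (gt_mem_nhds hx)).exists
    · rintro ⟨n, hn⟩
      exact (hua n).trans hn
  have := tendsto_measure_iUnion_atTop (μ := μ)
    (s := fun n => {x : EuclideanSpace ℝ (Fin d) | u n < ‖x‖})
    (fun m n hmn x hx => lt_of_le_of_lt (hu.antitone hmn) hx)
  rw [← hU] at this
  exact (ENNReal.tendsto_toReal (h.measure_norm_gt_lt_top ha).ne).comp this

theorem exists_tendsto_ratio (h : IsRegularlyVarying L id μ) {b c : ℝ} (hb : 0 ≤ b) (hbc : b < c) :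
    ∃ a ∈ Set.Ioo b c,
      Tendsto (fun t : ℝ => L.real {x | a * t < ‖x‖} / L.real {x | t < ‖x‖}) atTop
        (𝓝 (μ.real {x | a < ‖x‖})) := by
  obtain ⟨a, ha, ham⟩ := (h.countable_charged_spheres.dense_compl ℝ).exists_between hbc
  have ha0 : 0 < a := hb.trans_lt ham.1
  refine ⟨a, ham, h.tendsto_ratio ha0 ?_⟩
  by_contra hne
  exact ha ⟨ha0, hne⟩

variable [IsProbabilityMeasure L]

theorem tail_pos (h : IsRegularlyVarying L id μ) (t : ℝ) : 0 < L.real {x | t < ‖x‖} :=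
  ENNReal.toReal_pos (h.tail_ne_zero t) (measure_ne_top _ _)

/-- P(R > abt)/P(R > t) is the product of P(R > abt)/P(R > bt) and P(R > bt)/P(R > t). This gives
the identity when none of the three spheres is charged; right-continuity of the tail extends it
first to all `a`, then to all `b`. -/
theorem measureReal_norm_gt_mul (h : IsRegularlyVarying L id μ) {a b : ℝ} (ha : 0 < a)
    (hb : 0 < b) :
    μ.real {x | a * b < ‖x‖} = μ.real {x | a < ‖x‖} * μ.real {x | b < ‖x‖} := by
  set C := {a : ℝ | 0 < a ∧ μ {x | ‖x‖ = a} ≠ 0} with hC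
  have hCc : C.Countable := h.countable_charged_spheres
  have hnull : ∀ {a : ℝ}, 0 < a → a ∉ C → μ {x | ‖x‖ = a} = 0 := by
    intro a ha haC
    by_contra hne
    exact haC ⟨ha, hne⟩
  have h1 : ∀ {a b : ℝ}, 0 < a → 0 < b → a ∉ C → b ∉ C → a * b ∉ C →
      μ.real {x | a * b < ‖x‖} = μ.real {x | a < ‖x‖} * μ.real {x | b < ‖x‖} := by
    intro a b ha hb haC hbC habC
    refine tendsto_nhds_unique (h.tendsto_ratio (mul_pos ha hb) (hnull (mul_pos ha hb) habC)) ?_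
    have hmul := ((h.tendsto_ratio ha (hnull ha haC)).comp
      (tendsto_id.const_mul_atTop hb)).mul (h.tendsto_ratio hb (hnull hb hbC))
    refine hmul.congr fun t => ?_
    simp only [Function.comp, id]
    rw [div_mul_div_cancel₀ (h.tail_pos _).ne', mul_assoc]
  have h2 : ∀ {a b : ℝ}, 0 < a → 0 < b → b ∉ C →
      μ.real {x | a * b < ‖x‖} = μ.real {x | a < ‖x‖} * μ.real {x | b < ‖x‖} := by
    intro a b ha hb hbC
    have hcount : (C ∪ (fun x => x * b) ⁻¹' C).Countable :=
      hCc.union (hCc.preimage_of_injOn fun x _ y _ hxy => mul_right_cancel₀ hb.ne' hxy)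
    obtain ⟨u, hu, hmem, hlim⟩ := (hcount.dense_compl ℝ).exists_seq_strictAnti_tendsto a
    have hu0 : ∀ n, a < u n := fun n => (hmem n).1
    have hgood : ∀ n, u n ∉ C ∧ u n * b ∉ C := fun n => by
      have := (hmem n).2
      simpa [not_or] using this
    have hl1 := h.tendsto_measure_norm_gt ha hu hu0 hlim
    have hl2 := h.tendsto_measure_norm_gt (mul_pos ha hb) (u := fun n => u n * b)
      (fun m n hmn => mul_lt_mul_of_pos_right (hu hmn) hb)
      (fun n => mul_lt_mul_of_pos_right (hu0 n) hb) (hlim.mul_const b)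
    refine tendsto_nhds_unique hl2 ((hl1.mul_const _).congr fun n => ?_)
    exact (h1 (ha.trans (hu0 n)) hb (hgood n).1 hbC (hgood n).2).symm
  obtain ⟨v, hv, hmem, hlim⟩ := (hCc.dense_compl ℝ).exists_seq_strictAnti_tendsto b
  have hv0 : ∀ n, b < v n := fun n => (hmem n).1
  have hl1 := h.tendsto_measure_norm_gt hb hv hv0 hlim
  have hl2 := h.tendsto_measure_norm_gt (mul_pos ha hb) (u := fun n => a * v n)
    (fun m n hmn => mul_lt_mul_of_pos_left (hv hmn) ha)
    (fun n => mul_lt_mul_of_pos_left (hv0 n) ha) (hlim.const_mul a)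
  refine tendsto_nhds_unique hl2 ((hl1.const_mul _).congr fun n => ?_)
  exact (h2 ha (hb.trans (hv0 n)) (hmem n).2).symm

/-- Multiplicativity makes the tail at 1 idempotent, and the value 0 would make every tail vanish.
-/
theorem measureReal_norm_gt_one (h : IsRegularlyVarying L id μ) :
    μ.real {x | 1 < ‖x‖} = 1 := by
  have hm := h.measureReal_norm_gt_mul one_pos one_pos
  rw [mul_one] at hm
  by_contra hne
  have h0 : μ.real {x | 1 < ‖x‖} = 0 := by
    by_contra hne0
    exact hne (mul_left_cancel₀ hne0 (by rw [mul_one]; exact hm.symm))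
  refine h.eq_zero_of_norm_gt fun a ha => ⟨a, le_rfl, ?_⟩
  have hma := h.measureReal_norm_gt_mul ha one_pos
  rw [mul_one, h0, mul_zero, measureReal_def, ENNReal.toReal_eq_zero_iff] at hma
  exact hma.resolve_right (h.measure_norm_gt_lt_top ha).ne

/-- If the tail equalled 1 at `a`, it would equal 1 at every power of `a`, although these sets
decrease to the empty set. -/
theorem measureReal_norm_gt_lt_one (h : IsRegularlyVarying L id μ) {a : ℝ} (ha : 1 < a) :
    μ.real {x | a < ‖x‖} < 1 := by
  have ha0 : 0 < a := one_pos.trans ha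
  have hle : μ.real {x | a < ‖x‖} ≤ 1 := by
    rw [← h.measureReal_norm_gt_one]
    exact measureReal_mono (fun x hx => lt_trans ha hx) (h.measure_norm_gt_lt_top one_pos).ne
  refine lt_of_le_of_ne hle fun heq => ?_
  have hpow : ∀ n : ℕ, μ.real {x | a ^ n < ‖x‖} = 1 := by
    intro n
    induction n with
    | zero => simpa using h.measureReal_norm_gt_one
    | succ n ih => rw [pow_succ, h.measureReal_norm_gt_mul (pow_pos ha0 n) ha0, ih, heq, one_mul]
  have hlim := tendsto_measure_iInter_atTop (μ := μ)
    (s := fun n : ℕ => {x : EuclideanSpace ℝ (Fin d) | a ^ n < ‖x‖})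
    (fun n => (measurableSet_norm_gt _).nullMeasurableSet)
    (fun m n hmn x hx => lt_of_le_of_lt (pow_le_pow_right₀ ha.le hmn) hx)
    ⟨0, (h.measure_norm_gt_lt_top (by simp)).ne⟩
  have hempty : ⋂ n : ℕ, {x : EuclideanSpace ℝ (Fin d) | a ^ n < ‖x‖} = ∅ := by
    ext x
    simp only [Set.mem_iInter, Set.mem_ofPred_eq, Set.mem_empty_iff_false, iff_false, not_forall,
      not_lt]
    obtain ⟨n, hn⟩ := pow_unbounded_of_one_lt ‖x‖ ha
    exact ⟨n, hn.le⟩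
  rw [hempty, measure_empty] at hlim
  have hlim' := (ENNReal.tendsto_toReal ENNReal.zero_ne_top).comp hlim
  have : Tendsto (fun n : ℕ => μ.real {x | a ^ n < ‖x‖}) atTop (𝓝 0) := by
    simpa [Function.comp_def, measureReal_def] using hlim'
  simp only [hpow] at this
  exact one_ne_zero (tendsto_nhds_unique tendsto_const_nhds this)

theorem one_lt_measureReal_norm_gt (h : IsRegularlyVarying L id μ) {a : ℝ} (ha : 0 < a)
    (ha1 : a < 1) : 1 < μ.real {x | a < ‖x‖} := by
  have hm := h.measureReal_norm_gt_mul ha (inv_pos.2 ha)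
  rw [mul_inv_cancel₀ ha.ne', h.measureReal_norm_gt_one] at hm
  have h1 := h.measureReal_norm_gt_lt_one ((one_lt_inv₀ ha).2 ha1)
  have h2 : 0 ≤ μ.real {x | a⁻¹ < ‖x‖} := measureReal_nonneg
  have h3 : 0 ≤ μ.real {x | a < ‖x‖} := measureReal_nonneg
  by_contra hle
  nlinarith

/-- The mass of the sphere is at most the tail at 1/u minus 1. By multiplicativity that tail is the
reciprocal of the tail at u, which tends to 1 as u ↓ 1. -/
theorem measure_unit_sphere (h : IsRegularlyVarying L id μ) : μ {x | ‖x‖ = 1} = 0 := by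
  obtain ⟨u, hu, hu1, hlim⟩ := exists_seq_strictAnti_tendsto (1 : ℝ)
  have hu0 : ∀ n, 0 < u n := fun n => one_pos.trans (hu1 n)
  have hl := h.tendsto_measure_norm_gt one_pos hu hu1 hlim
  rw [h.measureReal_norm_gt_one] at hl
  have hl' : Tendsto (fun n => μ.real {x | (u n)⁻¹ < ‖x‖} - 1) atTop (𝓝 0) := by
    have := (hl.inv₀ one_ne_zero).sub_const 1
    simp only [inv_one, sub_self] at this
    refine this.congr fun n => ?_
    have hm := h.measureReal_norm_gt_mul (hu0 n) (inv_pos.2 (hu0 n))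
    rw [mul_inv_cancel₀ (hu0 n).ne', h.measureReal_norm_gt_one] at hm
    rw [eq_inv_of_mul_eq_one_right hm.symm]
  have hbound : ∀ n, μ.real {x | ‖x‖ = 1} ≤ μ.real {x | (u n)⁻¹ < ‖x‖} - 1 := by
    intro n
    have hlt : (u n)⁻¹ < 1 := inv_lt_one_of_one_lt₀ (hu1 n)
    have hfin := (h.measure_norm_gt_lt_top (inv_pos.2 (hu0 n))).ne
    have hdisj : Disjoint {x : EuclideanSpace ℝ (Fin d) | ‖x‖ = 1} {x | 1 < ‖x‖} := by
      rw [Set.disjoint_left]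
      intro x hx hx'
      exact absurd hx (ne_of_gt hx')
    have hsub : {x : EuclideanSpace ℝ (Fin d) | ‖x‖ = 1} ∪ {x | 1 < ‖x‖} ⊆
        {x | (u n)⁻¹ < ‖x‖} := by
      rintro x (hx | hx)
      · exact hlt.trans_le (le_of_eq hx.symm)
      · exact hlt.trans hx
    have hfin1 : μ {x : EuclideanSpace ℝ (Fin d) | ‖x‖ = 1} ≠ ⊤ :=
      ne_top_of_le_ne_top hfin (measure_mono (Set.subset_union_left.trans hsub))
    have := measureReal_mono hsub hfin
    rw [measureReal_union hdisj (measurableSet_norm_gt 1) hfin1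
      (h.measure_norm_gt_lt_top one_pos).ne, h.measureReal_norm_gt_one] at this
    linarith
  have h0 : μ.real {x | ‖x‖ = 1} ≤ 0 := ge_of_tendsto hl' (Eventually.of_forall hbound)
  have h00 := le_antisymm h0 measureReal_nonneg
  have hfin1 : μ {x : EuclideanSpace ℝ (Fin d) | ‖x‖ = 1} ≠ ⊤ := by
    refine ne_top_of_le_ne_top (h.measure_norm_gt_lt_top (a := 1 / 2) (by norm_num)).ne
      (measure_mono fun x hx => ?_)
    have hx1 : ‖x‖ = 1 := hx
    change 1 / 2 < ‖x‖
    rw [hx1]; norm_num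
  rw [measureReal_def, ENNReal.toReal_eq_zero_iff] at h00
  exact h00.resolve_right hfin1

theorem isProbabilityMeasure_limitModel (h : IsRegularlyVarying L id μ) :
    IsProbabilityMeasure (limitModel μ) := by
  constructor
  rw [limitModel, Measure.restrict_apply_univ,
    ← ENNReal.toReal_eq_one_iff]
  exact h.measureReal_norm_gt_one

end IsRegularlyVarying

/-! ### Weak convergence of the exceedances and of their rescaled values -/

theorem measurable_rescale {d : ℕ} {ω : EuclideanSpace ℝ (Fin d) → ℝ} (hω : Measurable ω) :
    Measurable (rescale ω) :=
  hω.smul measurable_id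

namespace IsRegularlyVarying

variable {d : ℕ} {L μ : Measure (EuclideanSpace ℝ (Fin d))} [IsProbabilityMeasure L]

/-- Given `t < ‖x‖`, the vector `x / t` converges weakly to the limit model. -/
theorem limitModel_le_liminf (h : IsRegularlyVarying L id μ)
    {G : Set (EuclideanSpace ℝ (Fin d))} (hG : IsOpen G) :
    limitModel μ G ≤ liminf (fun t : ℝ => (L[|{x | t < ‖x‖}]).map (fun x => t⁻¹ • x) G) atTop := by
  have := h.isProbabilityMeasure_limitModel
  have : ∀ t : ℝ, IsProbabilityMeasure ((L[|{x | t < ‖x‖}]).map fun x => t⁻¹ • x) := fun t => by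
    have := cond_isProbabilityMeasure (h.tail_ne_zero t)
    exact Measure.isProbabilityMeasure_map (by fun_prop)
  refine le_liminf_measure_open_of_forall_tendsto_measure (fun {B} hB hfr => ?_) G hG
  set A : Set (EuclideanSpace ℝ (Fin d)) := {x | 1 < ‖x‖} with hA
  have hAm : MeasurableSet A := measurableSet_norm_gt 1
  have hBA : MeasurableSet (B ∩ A) := hB.inter hAm
  have hcl : 0 ∉ closure (B ∩ A) := fun h0 =>
    zero_notMem_closure_norm_gt one_pos (closure_mono Set.inter_subset_right h0)
  -- The boundary created by intersecting with {‖x‖ > 1} lies on the unit sphere, which is `μ`-null.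
  have hfr' : μ (frontier (B ∩ A)) = 0 := by
    rw [limitModel, Measure.restrict_apply isClosed_frontier.measurableSet] at hfr
    refine measure_mono_null (t := (frontier B ∩ A) ∪ {x | ‖x‖ = 1}) (fun x hx => ?_)
      (measure_union_null hfr h.measure_unit_sphere)
    rcases frontier_inter_subset B A hx with hx | hx
    · have h1 : (1 : ℝ) ≤ ‖x‖ := by
        have : closure A ⊆ {x | (1 : ℝ) ≤ ‖x‖} :=
          closure_minimal (fun y hy => show (1 : ℝ) ≤ ‖y‖ from le_of_lt (show 1 < ‖y‖ from hy))
            (isClosed_le continuous_const continuous_norm)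
        exact this hx.2
      rcases h1.lt_or_eq with h1 | h1
      · exact Or.inl ⟨hx.1, h1⟩
      · exact Or.inr h1.symm
    · exact Or.inr (frontier_norm_gt_subset 1 hx.2)
  have hlim := h.tendsto _ hBA hcl hfr'
  rw [limitModel, Measure.restrict_apply hB]
  refine hlim.congr' ?_
  filter_upwards [eventually_gt_atTop 0] with t ht
  rw [Measure.map_apply (by fun_prop) hB, cond_apply (measurableSet_norm_gt t), ENNReal.div_eq_inv_mul]
  congr 2
  ext x
  simp only [id, hA, Set.mem_inter_iff, Set.mem_ofPred_eq, Set.mem_preimage, norm_smul, norm_inv,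
    Real.norm_of_nonneg ht.le]
  rw [← div_eq_inv_mul ‖x‖, one_lt_div ht, and_comm]

/-- An extended continuous mapping argument: θ is applied to t·(x/t), so the maps y ↦ θ(ty) vary
with t and approach θ locally. The portmanteau inequality is used for open sets on which θ(ty) ∈ G
for all large t. -/
theorem limitModel_map_rescale_le_liminf (h : IsRegularlyVarying L id μ)
    {ω : EuclideanSpace ℝ (Fin d) → ℝ} (hω : Measurable ω) (hωhom : AsymptoticallyHomogeneous ω μ)
    {G : Set (EuclideanSpace ℝ (Fin d))} (hG : IsOpen G) :
    (limitModel μ).map (rescale ω) G ≤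
      liminf (fun t : ℝ => (L[|{x | t < ‖x‖}]).map (rescale ω) G) atTop := by
  set V : ℕ → Set (EuclideanSpace ℝ (Fin d)) := fun T =>
    interior {y | ∀ t : ℝ, (T : ℝ) ≤ t → rescale ω (t • y) ∈ G} with hV
  have hVmono : Monotone V := fun m n hmn => interior_mono fun y hy t ht =>
    hy t ((Nat.cast_le.2 hmn).trans ht)
  have hae : ∀ᵐ x ∂(limitModel μ), x ∈ rescale ω ⁻¹' G → x ∈ ⋃ T, V T := by
    filter_upwards [hωhom] with x hx hxG
    have hlim : Tendsto (fun p : ℝ × EuclideanSpace ℝ (Fin d) => rescale ω (p.1 • p.2))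
        (atTop ×ˢ 𝓝 x) (𝓝 (rescale ω x)) := by
      have h2 : Tendsto (fun p : ℝ × EuclideanSpace ℝ (Fin d) => p.2) (atTop ×ˢ 𝓝 x) (𝓝 x) :=
        tendsto_snd
      refine (hx.smul h2).congr fun p => ?_
      rw [rescale, smul_smul, mul_comm]
    obtain ⟨pa, hpa, pb, hpb, hab⟩ := eventually_prod_iff.1 (hlim.eventually (hG.mem_nhds hxG))
    obtain ⟨T, hT⟩ := eventually_atTop.1 hpa
    refine Set.mem_iUnion.2 ⟨⌈T⌉₊, mem_interior_iff_mem_nhds.2 ?_⟩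
    filter_upwards [hpb] with y hy t ht
    exact hab (hT t ((Nat.le_ceil T).trans ht)) hy
  rw [Measure.map_apply (measurable_rescale hω) hG.measurableSet]
  have hle : limitModel μ (rescale ω ⁻¹' G) ≤ limitModel μ (⋃ T, V T) := measure_mono_ae hae
  refine hle.trans ?_
  rw [hVmono.measure_iUnion]
  refine iSup_le fun T => (h.limitModel_le_liminf isOpen_interior).trans ?_
  refine liminf_le_liminf ?_
  filter_upwards [eventually_ge_atTop (T : ℝ), eventually_gt_atTop 0] with t hT ht
  rw [Measure.map_apply (by fun_prop) isOpen_interior.measurableSet,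
    Measure.map_apply (measurable_rescale hω) hG.measurableSet]
  refine measure_mono fun x hx => ?_
  have := interior_subset hx t hT
  rwa [smul_smul, mul_inv_cancel₀ ht.ne', one_smul] at this

/-- The set {‖y‖ > C} is open and null for every conditional law, so the liminf bound makes it null
in the limit. -/
theorem ae_limitModel_norm_rescale_le (h : IsRegularlyVarying L id μ)
    {ω : EuclideanSpace ℝ (Fin d) → ℝ} (hω : Measurable ω) (hωhom : AsymptoticallyHomogeneous ω μ)
    {C : ℝ} (hC : ∀ᵐ x ∂L, ‖rescale ω x‖ ≤ C) : ∀ᵐ x ∂(limitModel μ), ‖rescale ω x‖ ≤ C := by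
  have hG : IsOpen {y : EuclideanSpace ℝ (Fin d) | C < ‖y‖} :=
    isOpen_lt continuous_const continuous_norm
  have hle := h.limitModel_map_rescale_le_liminf hω hωhom hG
  have h0 : ∀ t : ℝ, (L[|{x | t < ‖x‖}]).map (rescale ω) {y | C < ‖y‖} = 0 := by
    intro t
    rw [Measure.map_apply (measurable_rescale hω) hG.measurableSet]
    refine cond_absolutelyContinuous (measure_mono_null (fun x hx => ?_) hC)
    simpa using hx
  simp only [h0, liminf_const, nonpos_iff_eq_zero] at hle
  rw [Measure.map_apply (measurable_rescale hω) hG.measurableSet] at hle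
  refine measure_mono_null (fun x hx => ?_) hle
  simpa using hx

/-- Conditional means of continuous functions of the bounded rescaled vector converge to the mean
under the limit model. -/
theorem tendsto_integral_cond (h : IsRegularlyVarying L id μ)
    {ω : EuclideanSpace ℝ (Fin d) → ℝ} (hω : Measurable ω) (hωhom : AsymptoticallyHomogeneous ω μ)
    {C : ℝ} (hC : ∀ᵐ x ∂L, ‖rescale ω x‖ ≤ C) {f : EuclideanSpace ℝ (Fin d) → ℝ}
    (hf : Continuous f) :
    Tendsto (fun t : ℝ => ∫ x, f (rescale ω x) ∂(L[|{x | t < ‖x‖}])) atTop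
      (𝓝 (∫ x, f (rescale ω x) ∂(limitModel μ))) := by
  have hθ := measurable_rescale hω
  have := h.isProbabilityMeasure_limitModel
  have hcond : ∀ t : ℝ, IsProbabilityMeasure (L[|{x | t < ‖x‖}]) := fun t =>
    cond_isProbabilityMeasure (h.tail_ne_zero t)
  obtain ⟨M, hM⟩ := (isCompact_closedBall (0 : EuclideanSpace ℝ (Fin d)) C).exists_bound_of_continuousOn
    hf.continuousOn
  have hMC : ∀ y : EuclideanSpace ℝ (Fin d), ‖y‖ ≤ C → max (-M) (min (f y) M) = f y := by
    intro y hy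
    have := abs_le.1 (hM y (by simpa using hy))
    rw [min_eq_left this.2, max_eq_right this.1]
  -- Truncation at `±M` makes the test function bounded and leaves it unchanged on the ball of
  -- radius `C`, where all the laws involved live.
  set f' : BoundedContinuousFunction (EuclideanSpace ℝ (Fin d)) ℝ :=
    BoundedContinuousFunction.ofNormedAddCommGroup (fun y => max (-M) (min (f y) M))
      (by fun_prop) |M| (fun y => by
        rw [Real.norm_eq_abs, abs_le]
        constructor
        · exact (neg_le_neg (le_abs_self M)).trans (le_max_left _ _)
        · exact max_le (neg_le_abs M) ((min_le_right _ _).trans (le_abs_self M))) with hf'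
  let μs : ℝ → ProbabilityMeasure (EuclideanSpace ℝ (Fin d)) := fun t =>
    ⟨(L[|{x | t < ‖x‖}]).map (rescale ω), Measure.isProbabilityMeasure_map hθ.aemeasurable⟩
  let μ' : ProbabilityMeasure (EuclideanSpace ℝ (Fin d)) :=
    ⟨(limitModel μ).map (rescale ω), Measure.isProbabilityMeasure_map hθ.aemeasurable⟩
  have hconv : Tendsto μs atTop (𝓝 μ') := tendsto_of_forall_isOpen_le_liminf' fun G hG =>
    h.limitModel_map_rescale_le_liminf hω hωhom hG
  have hint := ProbabilityMeasure.tendsto_iff_forall_integral_tendsto.1 hconv f'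
  have hmap : ∀ ν : Measure (EuclideanSpace ℝ (Fin d)), (∀ᵐ x ∂ν, ‖rescale ω x‖ ≤ C) →
      ∫ y, f' y ∂(ν.map (rescale ω)) = ∫ x, f (rescale ω x) ∂ν := by
    intro ν hν
    rw [integral_map hθ.aemeasurable f'.continuous.aestronglyMeasurable]
    refine integral_congr_ae ?_
    filter_upwards [hν] with x hx
    exact hMC _ hx
  have h1 : ∫ y, f' y ∂(μ' : Measure (EuclideanSpace ℝ (Fin d))) =
      ∫ x, f (rescale ω x) ∂(limitModel μ) :=
    hmap _ (h.ae_limitModel_norm_rescale_le hω hωhom hC)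
  rw [h1] at hint
  exact hint.congr fun t => hmap _ (cond_absolutelyContinuous.ae_le hC)

end IsRegularlyVarying

/-! ### The quantile and the empirical threshold -/

namespace IsRegularlyVarying

variable {d : ℕ} {L μ : Measure (EuclideanSpace ℝ (Fin d))} [IsProbabilityMeasure L] {k : ℕ → ℕ}

theorem measureReal_norm_le_eq (L : Measure (EuclideanSpace ℝ (Fin d))) [IsProbabilityMeasure L]
    (r : ℝ) : L.real {x | ‖x‖ ≤ r} = 1 - L.real {x | r < ‖x‖} := by
  have h := probReal_compl_eq_one_sub (μ := L) (measurableSet_norm_gt (d := d) r)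
  rw [← h]
  congr 1
  ext x
  simp

theorem eventually_pos_div (hk : Tendsto k atTop atTop) :
    ∀ᶠ n : ℕ in atTop, 0 < (k n : ℝ) / n := by
  filter_upwards [hk.eventually_gt_atTop 0, eventually_gt_atTop 0] with n h1 h2
  positivity

theorem nonempty_quantileSet (L : Measure (EuclideanSpace ℝ (Fin d))) [IsProbabilityMeasure L]
    {p : ℝ} (hp : 0 < p) : ∃ r, 1 - p ≤ L.real {x | ‖x‖ ≤ r} := by
  have hlim := tendsto_measure_iUnion_atTop (μ := L)
    (s := fun n : ℕ => {x : EuclideanSpace ℝ (Fin d) | ‖x‖ ≤ n})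
    (fun m n hmn x hx => le_trans (show ‖x‖ ≤ m from hx) (Nat.cast_le.2 hmn))
  have hU : ⋃ n : ℕ, {x : EuclideanSpace ℝ (Fin d) | ‖x‖ ≤ n} = Set.univ := by
    ext x
    simpa using exists_nat_ge ‖x‖
  rw [hU, measure_univ] at hlim
  have hlim' : Tendsto (fun n : ℕ => L.real {x | ‖x‖ ≤ n}) atTop (𝓝 1) :=
    (ENNReal.tendsto_toReal ENNReal.one_ne_top).comp hlim
  obtain ⟨n, hn⟩ := (hlim'.eventually (lt_mem_nhds (show 1 - p < 1 by linarith))).exists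
  exact ⟨n, hn.le⟩

theorem tendsto_tailQuantile (h : IsRegularlyVarying L id μ) (hk : Tendsto k atTop atTop)
    (hkn : Tendsto (fun n => (k n : ℝ) / n) atTop (𝓝 0)) :
    Tendsto (fun n => tailQuantile L id n (k n)) atTop atTop := by
  refine tendsto_atTop.2 fun M => ?_
  filter_upwards [eventually_pos_div hk, hkn.eventually (gt_mem_nhds (h.tail_pos M))] with n h1 h2
  refine le_csInf (nonempty_quantileSet L h1) fun r hr => ?_
  by_contra hlt
  have hr' : 1 - (k n : ℝ) / n ≤ L.real {x | ‖x‖ ≤ r} := hr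
  have hmono : L.real {x | M < ‖x‖} ≤ L.real {x | r < ‖x‖} :=
    measureReal_mono fun x hx => lt_trans (not_le.1 hlt) hx
  rw [measureReal_norm_le_eq] at hr'
  linarith

theorem continuousAt_measureReal_norm_le (L : Measure (EuclideanSpace ℝ (Fin d)))
    [IsProbabilityMeasure L] {r : ℝ} (hr : L {x | ‖x‖ = r} = 0) :
    ContinuousAt (fun r => L.real {x | ‖x‖ ≤ r}) r := by
  have : IsProbabilityMeasure (L.map norm) :=
    Measure.isProbabilityMeasure_map measurable_norm.aemeasurable
  have hF : (fun r => L.real {x | ‖x‖ ≤ r}) = cdf (L.map norm) := by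
    funext r
    rw [cdf_eq_real, map_measureReal_apply measurable_norm measurableSet_Iic]
    rfl
  rw [hF, (monotone_cdf _).continuousAt_iff_leftLim_eq_rightLim, StieltjesFunction.rightLim_eq]
  have h0 : L.map norm {r} = 0 := by
    rw [Measure.map_apply measurable_norm (measurableSet_singleton r)]
    exact hr
  rw [← measure_cdf (L.map norm), StieltjesFunction.measure_singleton,
    ENNReal.ofReal_eq_zero] at h0
  exact le_antisymm ((monotone_cdf _).leftLim_le le_rfl) (by linarith)

/-- The quantile tends to infinity, so it eventually lies where the distribution function is
continuous. Approaching it through the quantile set and from the left gives the two inequalities. -/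
theorem eventually_tail_tailQuantile (h : IsRegularlyVarying L id μ) (hk : Tendsto k atTop atTop)
    (hkn : Tendsto (fun n => (k n : ℝ) / n) atTop (𝓝 0)) {r₀ : ℝ}
    (hcont : ∀ r, r₀ ≤ r → L {x | ‖x‖ = r} = 0) :
    ∀ᶠ n : ℕ in atTop, L.real {x | tailQuantile L id n (k n) < ‖x‖} = (k n : ℝ) / n := by
  filter_upwards [eventually_pos_div hk, hkn.eventually (gt_mem_nhds one_pos),
    (h.tendsto_tailQuantile hk hkn).eventually_ge_atTop r₀] with n h1 h2 h3
  set q := tailQuantile L id n (k n) with hq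
  set S := {r : ℝ | 1 - (k n : ℝ) / n ≤ L.real {x | ‖x‖ ≤ r}} with hS
  have hqS : q = sInf S := rfl
  have hne : S.Nonempty := nonempty_quantileSet L h1
  have hbdd : BddBelow S := by
    refine ⟨0, fun r hr => ?_⟩
    by_contra hlt
    have : {x : EuclideanSpace ℝ (Fin d) | ‖x‖ ≤ r} = ∅ := by
      ext x
      simpa using (not_le.1 hlt).trans_le (norm_nonneg x)
    have hr' : 1 - (k n : ℝ) / n ≤ L.real {x | ‖x‖ ≤ r} := hr
    rw [this, measureReal_empty] at hr'
    linarith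
  have hc := continuousAt_measureReal_norm_le L (hcont q h3)
  have hge : 1 - (k n : ℝ) / n ≤ L.real {x | ‖x‖ ≤ q} := by
    obtain ⟨u, -, hu, hmem⟩ := exists_seq_tendsto_sInf hne hbdd
    exact ge_of_tendsto (hc.tendsto.comp hu) (Eventually.of_forall hmem)
  have hle : L.real {x | ‖x‖ ≤ q} ≤ 1 - (k n : ℝ) / n := by
    have hlt : ∀ᶠ r in 𝓝[<] q, L.real {x | ‖x‖ ≤ r} ≤ 1 - (k n : ℝ) / n := by
      filter_upwards [self_mem_nhdsWithin] with r hr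
      by_contra hcon
      exact absurd (csInf_le hbdd (show r ∈ S from (not_le.1 hcon).le)) (not_le.2 hr)
    exact le_of_tendsto (hc.tendsto.mono_left nhdsWithin_le_nhds) hlt
  have := measureReal_norm_le_eq L q
  linarith

/-- This is the Chebyshev bound for a count with mean `k ρ` compared with `k`: it is of order 1/k as
long as the limiting ratio is not 1. -/
theorem tendsto_ratio_div_sq {ρ : ℕ → ℝ} {g : ℝ} (hρ : Tendsto ρ atTop (𝓝 g)) (hg : g ≠ 1)
    (hk : Tendsto k atTop atTop) :
    Tendsto (fun n => (k n * ρ n) / (k n - k n * ρ n) ^ 2) atTop (𝓝 0) := by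
  have hkr : Tendsto (fun n => (k n : ℝ)) atTop atTop := tendsto_natCast_atTop_atTop.comp hk
  have h1 : Tendsto (fun n => ρ n / (1 - ρ n) ^ 2) atTop (𝓝 (g / (1 - g) ^ 2)) :=
    hρ.div ((hρ.const_sub 1).pow 2) (pow_ne_zero 2 (sub_ne_zero.2 (Ne.symm hg)))
  have h2 := (tendsto_inv_atTop_zero.comp hkr).mul h1
  rw [zero_mul] at h2
  refine h2.congr' ?_
  filter_upwards [hk.eventually_gt_atTop 0] with n hn
  have hn' : (k n : ℝ) ≠ 0 := by exact_mod_cast hn.ne'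
  have h3 : (k n : ℝ) - k n * ρ n = k n * (1 - ρ n) := by ring
  simp only [Function.comp]
  rw [h3, mul_pow, sq (k n : ℝ), mul_assoc (k n : ℝ) (k n : ℝ), mul_div_mul_left _ _ hn',
    ← div_eq_inv_mul, div_div, mul_comm ((1 - ρ n) ^ 2)]

/-- The empirical threshold is asymptotically equivalent to the quantile, in probability. -/
theorem tendsto_upperOrderStat_mem (h : IsRegularlyVarying L id μ) (hk : Tendsto k atTop atTop)
    (hkn : Tendsto (fun n => (k n : ℝ) / n) atTop (𝓝 0)) {r₀ : ℝ}
    (hcont : ∀ r, r₀ ≤ r → L {x | ‖x‖ = r} = 0) {ε : ℝ} (hε : 0 < ε) (hε1 : ε < 1) :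
    Tendsto (fun n => (Measure.pi fun _ : Fin n => L).real
      {x | (upperOrderStat n (k n) fun i => ‖x i‖) ∉
        Set.Icc ((1 - ε) * tailQuantile L id n (k n)) ((1 + ε) * tailQuantile L id n (k n))})
      atTop (𝓝 0) := by
  set q := fun n => tailQuantile L id n (k n) with hq
  have hqlim : Tendsto q atTop atTop := h.tendsto_tailQuantile hk hkn
  -- Since 1 ± ε may be charged radii, slightly smaller deviations `a` and `b` are used. The
  -- expected number of exceedances of `a q` is then a proportion below 1 of `k`, that of `b q` a
  -- proportion above 1.
  obtain ⟨a, ⟨ha1, haε⟩, ha⟩ := h.exists_tendsto_ratio (b := 1) (c := 1 + ε) (by norm_num)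
    (by linarith)
  obtain ⟨b, ⟨hbε, hb1⟩, hb⟩ := h.exists_tendsto_ratio (b := 1 - ε) (c := 1) (by linarith)
    (by linarith)
  have hb0 : 0 < b := by linarith
  have hga := h.measureReal_norm_gt_lt_one ha1
  have hgb := h.one_lt_measureReal_norm_gt hb0 hb1
  have hρa := ha.comp hqlim
  have hρb := hb.comp hqlim
  have hbound := (tendsto_ratio_div_sq hρa hga.ne hk).add (tendsto_ratio_div_sq hρb hgb.ne' hk)
  rw [add_zero] at hbound
  refine squeeze_zero' (Eventually.of_forall fun n => measureReal_nonneg) ?_ hbound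
  filter_upwards [h.eventually_tail_tailQuantile hk hkn hcont, hqlim.eventually_gt_atTop 0,
    hk.eventually_gt_atTop 0, eventually_gt_atTop 0, hkn.eventually (gt_mem_nhds one_pos),
    hρa.eventually (gt_mem_nhds hga), hρb.eventually (lt_mem_nhds hgb)]
    with n htail hq0 hk0 hn0 hkn1 hra hrb
  have hn0' : (0 : ℝ) < n := Nat.cast_pos.2 hn0
  have hk0' : (0 : ℝ) < k n := Nat.cast_pos.2 hk0
  have hkltn : k n < n := by
    rw [div_lt_one hn0'] at hkn1
    exact_mod_cast hkn1
  have hmul : ∀ c : ℝ, (n : ℝ) * L.real {x | c * q n < ‖x‖} =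
      k n * (L.real {x | c * q n < ‖x‖} / L.real {x | q n < ‖x‖}) := by
    intro c
    rw [htail]
    field_simp
  simp only [Function.comp] at hra hrb ⊢
  rw [← hmul a, ← hmul b]
  have hA : (n : ℝ) * L.real {x | a * q n < ‖x‖} < k n := by
    rw [hmul a]
    exact mul_lt_of_lt_one_right hk0' hra
  have hB : (k n : ℝ) < n * L.real {x | b * q n < ‖x‖} := by
    rw [hmul b]
    exact lt_mul_of_one_lt_right hk0' hrb
  have h1 := measureReal_lt_upperOrderStat_le L measurable_norm hkltn hA
  have h2 := measureReal_upperOrderStat_le_le L measurable_norm hkltn hB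
  rw [← neg_sq, neg_sub] at h2
  refine le_trans (measureReal_mono ?_) ((measureReal_union_le _ _).trans (add_le_add h1 h2))
  intro x hx
  by_contra hcon
  simp only [Set.mem_union, Set.mem_ofPred_eq, not_or, not_lt, not_le] at hcon
  refine hx ⟨?_, ?_⟩
  · exact le_trans (mul_le_mul_of_nonneg_right hbε.le hq0.le) hcon.2.le
  · exact hcon.1.trans (mul_le_mul_of_nonneg_right haε.le hq0.le)

end IsRegularlyVarying

/-! ### Powers of conditional characteristic functions -/

theorem norm_pow_sub_pow_le_mul {z w : ℂ} (hz : ‖z‖ ≤ 1) (hw : ‖w‖ ≤ 1) (k : ℕ) :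
    ‖z ^ k - w ^ k‖ ≤ k * ‖z - w‖ := by
  induction k with
  | zero => simp
  | succ k ih =>
    have h : z ^ (k + 1) - w ^ (k + 1) = z ^ k * (z - w) + (z ^ k - w ^ k) * w := by ring
    rw [h]
    refine (norm_add_le _ _).trans ?_
    rw [norm_mul, norm_mul, norm_pow]
    have h1 : ‖z‖ ^ k * ‖z - w‖ ≤ 1 * ‖z - w‖ :=
      mul_le_mul_of_nonneg_right (pow_le_one₀ (norm_nonneg _) hz) (norm_nonneg _)
    have h2 : ‖z ^ k - w ^ k‖ * ‖w‖ ≤ k * ‖z - w‖ * 1 := by gcongr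
    push_cast
    linarith

/-- Compare `ψ` with exp(-c/k), whose k-th power is exactly the limit. Both lie in the unit disc, so
the powers differ by at most k times the difference, which tends to zero. No complex logarithm is
needed, and a general filter allows uniformity in a parameter. -/
theorem tendsto_pow_exp_neg {α : Type*} {F : Filter α} {k : α → ℕ} (hk : Tendsto k F atTop)
    {ψ : α → ℂ} (hψ : ∀ᶠ p in F, ‖ψ p‖ ≤ 1) {c : ℝ} (hc : 0 ≤ c)
    (hlim : Tendsto (fun p => (k p : ℂ) * (ψ p - 1)) F (𝓝 (-c))) :
    Tendsto (fun p => ψ p ^ k p) F (𝓝 (Complex.exp (-c))) := by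
  set E : α → ℂ := fun p => Complex.exp (-(c / k p : ℝ)) with hE
  have hkr : Tendsto (fun p => (k p : ℝ)) F atTop := tendsto_natCast_atTop_atTop.comp hk
  have hE1 : ∀ p, ‖E p‖ ≤ 1 := fun p => by
    change ‖Complex.exp (-((c / k p : ℝ) : ℂ))‖ ≤ 1
    rw [← Complex.ofReal_neg, Complex.norm_exp_ofReal, Real.exp_le_one_iff, neg_nonpos]
    positivity
  have hElim : Tendsto (fun p => (k p : ℂ) * (E p - 1)) F (𝓝 (-c)) := by
    have h0 : Tendsto (fun p => c / (k p : ℝ)) F (𝓝 0) := hkr.const_div_atTop c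
    have hbound : Tendsto (fun p => c * (c / (k p : ℝ))) F (𝓝 0) := by
      simpa using h0.const_mul c
    rw [tendsto_iff_norm_sub_tendsto_zero]
    refine squeeze_zero' (Eventually.of_forall fun p => norm_nonneg _) ?_ hbound
    filter_upwards [hk.eventually_gt_atTop 0, h0.eventually (gt_mem_nhds one_pos)] with p hp hp1
    have hp' : (k p : ℝ) ≠ 0 := by exact_mod_cast hp.ne'
    have hp'' : (k p : ℂ) ≠ 0 := by exact_mod_cast hp.ne'
    set y : ℂ := -(c / k p : ℝ) with hy
    have hyn : ‖y‖ = c / k p := by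
      rw [hy, norm_neg, Complex.norm_real, Real.norm_of_nonneg (by positivity)]
    have hb := Complex.norm_exp_sub_one_sub_id_le (x := y) (by rw [hyn]; exact hp1.le)
    have hky : (k p : ℂ) * y = -c := by
      rw [hy]
      push_cast
      field_simp
    have heq : (k p : ℂ) * (E p - 1) - -c = k p * (Complex.exp y - 1 - y) := by
      rw [← hky, hE]
      ring
    rw [heq, norm_mul, Complex.norm_natCast]
    calc (k p : ℝ) * ‖Complex.exp y - 1 - y‖ ≤ k p * (c / k p) ^ 2 := by
          rw [← hyn]; gcongr
      _ = c * (c / k p) := by field_simp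
  have hdiff : Tendsto (fun p => ‖(k p : ℂ) * (ψ p - 1) - k p * (E p - 1)‖) F (𝓝 0) := by
    have := (hlim.sub hElim).norm
    simpa using this
  rw [tendsto_iff_norm_sub_tendsto_zero]
  refine squeeze_zero' (Eventually.of_forall fun p => norm_nonneg _) ?_ hdiff
  filter_upwards [hψ, hk.eventually_gt_atTop 0] with p hp hk0
  have hp'' : (k p : ℂ) ≠ 0 := by exact_mod_cast hk0.ne'
  have hEk : E p ^ k p = Complex.exp (-c) := by
    rw [hE, ← Complex.exp_nat_mul]
    congr 1
    push_cast
    field_simp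
  rw [← hEk]
  refine (norm_pow_sub_pow_le_mul hp (hE1 p) _).trans (le_of_eq ?_)
  rw [← mul_sub, norm_mul, Complex.norm_natCast]
  congr 2
  ring

theorem norm_integral_exp_sub_taylor_le {E : Type*} [MeasurableSpace E] (ρ : Measure E)
    [IsProbabilityMeasure ρ] {Z : E → ℝ} (hZ : Measurable Z) {M y : ℝ} (hy : 0 ≤ y)
    (hM : ∀ᵐ x ∂ρ, |Z x| ≤ M) (hMy : y * M ≤ 1) :
    ‖∫ x, Complex.exp (((y * Z x : ℝ) : ℂ) * Complex.I) ∂ρ -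
      (1 + ((y * ∫ x, Z x ∂ρ : ℝ) : ℂ) * Complex.I - ((y ^ 2 * (∫ x, Z x ^ 2 ∂ρ) / 2 : ℝ) : ℂ))‖ ≤
      (y * M) ^ 3 := by
  have hZi : Integrable Z ρ := Integrable.of_bound hZ.aestronglyMeasurable M hM
  have hZ2i : Integrable (fun x => Z x ^ 2) ρ := by
    refine Integrable.of_bound (hZ.pow_const 2).aestronglyMeasurable (M ^ 2) ?_
    filter_upwards [hM] with x hx
    rw [Real.norm_eq_abs, abs_pow]
    gcongr
  have hexp : Integrable (fun x => Complex.exp (((y * Z x : ℝ) : ℂ) * Complex.I)) ρ := by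
    refine Integrable.of_bound (C := 1) ?_ (Eventually.of_forall fun x => ?_)
    · exact (Complex.measurable_exp.comp ((Complex.measurable_ofReal.comp
        (hZ.const_mul y)).mul_const _)).aestronglyMeasurable
    · rw [Complex.norm_exp_ofReal_mul_I]
  have h1 : Integrable (fun x => ((y * Z x : ℝ) : ℂ) * Complex.I) ρ :=
    ((hZi.const_mul y).ofReal).mul_const _
  have h2 : Integrable (fun x => ((y ^ 2 * Z x ^ 2 / 2 : ℝ) : ℂ)) ρ :=
    ((hZ2i.const_mul (y ^ 2)).div_const 2).ofReal
  have h01 : Integrable (fun x => 1 + ((y * Z x : ℝ) : ℂ) * Complex.I) ρ :=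
    (integrable_const _).add h1
  have h012 : Integrable (fun x => 1 + ((y * Z x : ℝ) : ℂ) * Complex.I -
      ((y ^ 2 * Z x ^ 2 / 2 : ℝ) : ℂ)) ρ := h01.sub h2
  have hT : (1 + ((y * ∫ x, Z x ∂ρ : ℝ) : ℂ) * Complex.I -
      ((y ^ 2 * (∫ x, Z x ^ 2 ∂ρ) / 2 : ℝ) : ℂ)) =
      ∫ x, (1 + ((y * Z x : ℝ) : ℂ) * Complex.I - ((y ^ 2 * Z x ^ 2 / 2 : ℝ) : ℂ)) ∂ρ := by
    rw [integral_sub h01 h2, integral_add (integrable_const _) h1,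
      integral_mul_const, integral_complex_ofReal, integral_complex_ofReal, integral_const_mul,
      integral_div, integral_const_mul]
    simp
  rw [hT, ← integral_sub hexp h012]
  refine (norm_integral_le_of_norm_le_const (C := (y * M) ^ 3) ?_).trans (by simp)
  filter_upwards [hM] with x hx
  set z : ℂ := ((y * Z x : ℝ) : ℂ) * Complex.I with hz
  have hzn : ‖z‖ = y * |Z x| := by
    rw [hz, norm_mul, Complex.norm_I, mul_one, Complex.norm_real, Real.norm_eq_abs, abs_mul,
      abs_of_nonneg hy]
  have hzle : ‖z‖ ≤ y * M := by rw [hzn]; gcongr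
  have hb := Complex.exp_bound (x := z) (hzle.trans hMy) (n := 3) (by norm_num)
  have hsum : ∑ m ∈ Finset.range 3, z ^ m / (m.factorial : ℂ) =
      1 + z - ((y ^ 2 * Z x ^ 2 / 2 : ℝ) : ℂ) := by
    rw [Finset.sum_range_succ, Finset.sum_range_succ, Finset.sum_range_one]
    have hz2 : z ^ 2 = -((y ^ 2 * Z x ^ 2 : ℝ) : ℂ) := by
      rw [hz, mul_pow, Complex.I_sq]
      push_cast
      ring
    rw [hz2]
    simp only [pow_zero, Nat.factorial_zero, Nat.cast_one, div_one, pow_one, Nat.factorial_one,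
      Nat.factorial_two]
    push_cast
    ring
  rw [← hsum]
  refine hb.trans ?_
  -- The constant in `Complex.exp_bound` at order 3 is 4/18.
  have h29 : ((Nat.succ 3 : ℕ) : ℝ) * ((Nat.factorial 3 : ℕ) * (3 : ℕ) : ℝ)⁻¹ ≤ 1 := by
    norm_num [Nat.factorial]
  calc ‖z‖ ^ 3 * (((Nat.succ 3 : ℕ) : ℝ) * ((Nat.factorial 3 : ℕ) * (3 : ℕ) : ℝ)⁻¹)
      ≤ ‖z‖ ^ 3 * 1 := by gcongr
    _ ≤ (y * M) ^ 3 := by rw [mul_one]; gcongr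

namespace IsRegularlyVarying

variable {d : ℕ} {L μ : Measure (EuclideanSpace ℝ (Fin d))} [IsProbabilityMeasure L] {k : ℕ → ℕ}

/-- The `k`-th powers of the conditional characteristic functions converge, uniformly over
thresholds comparable to the quantile, to a Gaussian characteristic function. -/
theorem eventually_norm_condCharFun_pow_sub_le (h : IsRegularlyVarying L id μ)
    {ω : EuclideanSpace ℝ (Fin d) → ℝ} (hω : Measurable ω) (hωhom : AsymptoticallyHomogeneous ω μ)
    {C : ℝ} (hC : ∀ᵐ x ∂L, ‖rescale ω x‖ ≤ C) {f : EuclideanSpace ℝ (Fin d) → ℝ}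
    (hf : Continuous f) (hk : Tendsto k atTop atTop) {q : ℕ → ℝ} (hq : Tendsto q atTop atTop)
    {ε : ℝ} (hε1 : ε < 1)
    (hbias : ∀ δ : ℝ, 0 < δ → ∀ᶠ n in atTop, ∀ s ∈ Set.Icc (1 - ε) (1 + ε),
      |∫ x, f (rescale ω x) ∂(L[|{x | s * q n < ‖x‖}]) -
        ∫ x, f (rescale ω x) ∂(L[|{x | q n < ‖x‖}])| ≤ δ * (√(k n))⁻¹)
    {η : ℝ} (hη : 0 < η) :
    ∀ᶠ n in atTop, ∀ s ∈ Set.Icc ((1 - ε) * q n) ((1 + ε) * q n),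
      ‖(∫ x, Complex.exp ((((√(k n))⁻¹ * (f (rescale ω x) -
        ∫ x, f (rescale ω x) ∂(L[|{x | q n < ‖x‖}])) : ℝ) : ℂ) * Complex.I)
          ∂(L[|{x | s < ‖x‖}])) ^ k n -
        Complex.exp (-(Var[fun x => f (rescale ω x); limitModel μ] / 2 : ℝ))‖ ≤ η := by
  have hθ := measurable_rescale hω
  have hcond : ∀ t : ℝ, IsProbabilityMeasure (L[|{x | t < ‖x‖}]) := fun t =>
    cond_isProbabilityMeasure (h.tail_ne_zero t)
  have := h.isProbabilityMeasure_limitModel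
  set v : EuclideanSpace ℝ (Fin d) → ℝ := fun x => f (rescale ω x) with hv
  have hvm : Measurable v := hf.measurable.comp hθ
  obtain ⟨M', hM'⟩ := (isCompact_closedBall (0 : EuclideanSpace ℝ (Fin d)) C).exists_bound_of_continuousOn
    hf.continuousOn
  set M := max M' 0 with hMdef
  have hM0 : 0 ≤ M := le_max_right _ _
  have hvM : ∀ ρ : Measure (EuclideanSpace ℝ (Fin d)), (∀ᵐ x ∂ρ, ‖rescale ω x‖ ≤ C) →
      ∀ᵐ x ∂ρ, |v x| ≤ M := by
    intro ρ hρ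
    filter_upwards [hρ] with x hx
    exact (hM' _ (by simpa using hx)).trans (le_max_left _ _)
  have hvt : ∀ t, ∀ᵐ x ∂(L[|{x | t < ‖x‖}]), |v x| ≤ M := fun t =>
    hvM _ (cond_absolutelyContinuous.ae_le hC)
  have hint : ∀ ρ : Measure (EuclideanSpace ℝ (Fin d)), IsProbabilityMeasure ρ →
      (∀ᵐ x ∂ρ, |v x| ≤ M) → Integrable v ρ ∧ Integrable (fun x => v x ^ 2) ρ := by
    intro ρ _ hρ
    refine ⟨Integrable.of_bound hvm.aestronglyMeasurable M hρ,
      Integrable.of_bound (hvm.pow_const 2).aestronglyMeasurable (M ^ 2) ?_⟩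
    filter_upwards [hρ] with x hx
    rw [Real.norm_eq_abs, abs_pow]
    gcongr
  have hm1 : Tendsto (fun t : ℝ => ∫ x, v x ∂(L[|{x | t < ‖x‖}])) atTop
      (𝓝 (∫ x, v x ∂(limitModel μ))) := h.tendsto_integral_cond hω hωhom hC hf
  have hm2 : Tendsto (fun t : ℝ => ∫ x, v x ^ 2 ∂(L[|{x | t < ‖x‖}])) atTop
      (𝓝 (∫ x, v x ^ 2 ∂(limitModel μ))) := h.tendsto_integral_cond hω hωhom hC (hf.pow 2)
  set a : ℕ → ℝ := fun n => ∫ x, v x ∂(L[|{x | q n < ‖x‖}]) with ha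
  have haM : ∀ n, |a n| ≤ M := fun n => by
    have := norm_integral_le_of_norm_le_const (f := v) (C := M) (hvt (q n))
    simpa using this
  -- Convergence along this filter on pairs (n, s) is convergence in n, uniform over s in the
  -- window; the uniform claim thus becomes an ordinary limit.
  set F : Filter (ℕ × ℝ) := (atTop ×ˢ (⊤ : Filter ℝ)) ⊓
    𝓟 {p : ℕ × ℝ | p.2 ∈ Set.Icc ((1 - ε) * q p.1) ((1 + ε) * q p.1)} with hF
  have hfst : Tendsto (fun p : ℕ × ℝ => p.1) F atTop := tendsto_fst.mono_left inf_le_left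
  have hmem : ∀ᶠ p : ℕ × ℝ in F, p.2 ∈ Set.Icc ((1 - ε) * q p.1) ((1 + ε) * q p.1) :=
    mem_inf_of_right (mem_principal_self _)
  have hsnd : Tendsto (fun p : ℕ × ℝ => p.2) F atTop := by
    refine tendsto_atTop_mono' F (f₁ := fun p => (1 - ε) * q p.1) ?_
      ((hq.comp hfst).const_mul_atTop (by linarith))
    filter_upwards [hmem] with p hp using hp.1
  have hkF : Tendsto (fun p : ℕ × ℝ => k p.1) F atTop := hk.comp hfst
  have hkFr : Tendsto (fun p : ℕ × ℝ => (k p.1 : ℝ)) F atTop :=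
    tendsto_natCast_atTop_atTop.comp hkF
  have hinv : Tendsto (fun p : ℕ × ℝ => (√(k p.1 : ℝ))⁻¹) F (𝓝 0) :=
    tendsto_inv_atTop_zero.comp (Real.tendsto_sqrt_atTop.comp hkFr)
  set m : ℝ → ℝ := fun s => ∫ x, v x ∂(L[|{x | s < ‖x‖}]) with hm
  set m₂ : ℝ → ℝ := fun s => ∫ x, v x ^ 2 ∂(L[|{x | s < ‖x‖}]) with hm₂
  have hbiasF : Tendsto (fun p : ℕ × ℝ => √(k p.1) * (m p.2 - a p.1)) F (𝓝 0) := by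
    rw [Metric.tendsto_nhds]
    intro δ hδ
    have hδ2 := hfst.eventually (hbias (δ / 2) (half_pos hδ))
    filter_upwards [hδ2, hmem, hkF.eventually_gt_atTop 0, (hq.comp hfst).eventually_gt_atTop 0]
      with p hp hps hpk hpq
    have hpq' : 0 < q p.1 := hpq
    have hs := hp (p.2 / q p.1) ⟨by rw [le_div_iff₀ hpq']; exact hps.1,
      by rw [div_le_iff₀ hpq']; exact hps.2⟩
    rw [div_mul_cancel₀ _ hpq'.ne'] at hs
    have hsq : 0 < √(k p.1 : ℝ) := Real.sqrt_pos.2 (by exact_mod_cast hpk)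
    rw [dist_zero_right, Real.norm_eq_abs, abs_mul, abs_of_pos hsq]
    calc √(k p.1 : ℝ) * |m p.2 - a p.1| ≤ √(k p.1 : ℝ) * (δ / 2 * (√(k p.1 : ℝ))⁻¹) := by gcongr
      _ = δ / 2 := by field_simp
      _ < δ := half_lt_self hδ
  set Z : ℕ → EuclideanSpace ℝ (Fin d) → ℝ := fun n x => v x - a n with hZ
  have hZm : ∀ n, Measurable (Z n) := fun n => hvm.sub_const _
  have hZM : ∀ n t, ∀ᵐ x ∂(L[|{x | t < ‖x‖}]), |Z n x| ≤ 2 * M := by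
    intro n t
    filter_upwards [hvt t] with x hx
    exact (abs_sub _ _).trans (by linarith [haM n])
  have hEZ : ∀ n s, ∫ x, Z n x ∂(L[|{x | s < ‖x‖}]) = m s - a n := by
    intro n s
    simp only [hZ]
    rw [integral_sub (hint _ (hcond s) (hvt s)).1 (integrable_const _)]
    simp [hm]
  have hEZ2 : ∀ n s, ∫ x, Z n x ^ 2 ∂(L[|{x | s < ‖x‖}]) =
      m₂ s - 2 * a n * m s + a n ^ 2 := by
    intro n s
    obtain ⟨i1, i2⟩ := hint _ (hcond s) (hvt s)
    have : ∀ x, Z n x ^ 2 = v x ^ 2 - 2 * a n * v x + a n ^ 2 := fun x => by simp only [hZ]; ring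
    have i3 : Integrable (fun x => v x ^ 2 - 2 * a n * v x) (L[|{x | s < ‖x‖}]) :=
      i2.sub (i1.const_mul _)
    simp only [this]
    rw [integral_add i3 (integrable_const _),
      integral_sub i2 (i1.const_mul _), integral_const_mul]
    simp [hm, hm₂]
  have hvar : Var[v; limitModel μ] =
      ∫ x, v x ^ 2 ∂(limitModel μ) - (∫ x, v x ∂(limitModel μ)) ^ 2 := by
    have hb := hvM _ (h.ae_limitModel_norm_rescale_le hω hωhom hC)
    rw [variance_eq_sub (MemLp.of_bound hvm.aestronglyMeasurable M hb)]
    rfl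
  have hsecond : Tendsto (fun p : ℕ × ℝ => ∫ x, Z p.1 x ^ 2 ∂(L[|{x | p.2 < ‖x‖}])) F
      (𝓝 (Var[v; limitModel μ])) := by
    simp only [hEZ2]
    have h1 := hm1.comp hsnd
    have h2 := hm2.comp hsnd
    have h3 := (hm1.comp hq).comp hfst
    have h4 := (h2.sub ((h3.const_mul 2).mul h1)).add (h3.pow 2)
    have hlim : Var[v; limitModel μ] = ∫ x, v x ^ 2 ∂(limitModel μ) -
        2 * (∫ x, v x ∂(limitModel μ)) * (∫ x, v x ∂(limitModel μ)) +
        (∫ x, v x ∂(limitModel μ)) ^ 2 := by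
      rw [hvar]
      ring
    rw [hlim]
    exact h4
  set ψ : ℕ × ℝ → ℂ := fun p => ∫ x, Complex.exp ((((√(k p.1))⁻¹ * Z p.1 x : ℝ) : ℂ) * Complex.I)
    ∂(L[|{x | p.2 < ‖x‖}]) with hψ
  have hψ1 : ∀ p, ‖ψ p‖ ≤ 1 := by
    intro p
    refine (norm_integral_le_of_norm_le_const (C := 1) (Eventually.of_forall fun x => ?_)).trans
      (by simp)
    rw [Complex.norm_exp_ofReal_mul_I]
  have hmain : Tendsto (fun p => (k p.1 : ℂ) * (ψ p - 1)) F
      (𝓝 (-(Var[v; limitModel μ] / 2 : ℝ))) := by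
    have hprinc : Tendsto (fun p : ℕ × ℝ => ((√(k p.1) * (m p.2 - a p.1) : ℝ) : ℂ) * Complex.I -
        (((∫ x, Z p.1 x ^ 2 ∂(L[|{x | p.2 < ‖x‖}])) / 2 : ℝ) : ℂ)) F
        (𝓝 (-(Var[v; limitModel μ] / 2 : ℝ))) := by
      have h1 := ((Complex.continuous_ofReal.tendsto _).comp hbiasF).mul_const Complex.I
      have h2 := (Complex.continuous_ofReal.tendsto _).comp (hsecond.div_const 2)
      have h3 := h1.sub h2
      rw [Complex.ofReal_zero, zero_mul, zero_sub] at h3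
      exact h3
    -- The cubic Taylor remainder (k^{-1/2}·2M)³, multiplied by k, is still of order k^{-1/2}; here
    -- `2 * M` bounds the centered variable.
    have hrem : Tendsto (fun p : ℕ × ℝ => (2 * M) ^ 3 * (√(k p.1 : ℝ))⁻¹) F (𝓝 0) := by
      simpa using hinv.const_mul ((2 * M) ^ 3)
    have hsmall : ∀ᶠ p : ℕ × ℝ in F, (√(k p.1 : ℝ))⁻¹ * (2 * M) ≤ 1 := by
      have : Tendsto (fun p : ℕ × ℝ => (√(k p.1 : ℝ))⁻¹ * (2 * M)) F (𝓝 0) := by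
        simpa using hinv.mul_const (2 * M)
      exact (this.eventually (gt_mem_nhds one_pos)).mono fun p hp => hp.le
    have hdiff : Tendsto (fun p : ℕ × ℝ => (k p.1 : ℂ) * (ψ p - 1) -
        (((√(k p.1) * (m p.2 - a p.1) : ℝ) : ℂ) * Complex.I -
        (((∫ x, Z p.1 x ^ 2 ∂(L[|{x | p.2 < ‖x‖}])) / 2 : ℝ) : ℂ))) F (𝓝 0) := by
      rw [tendsto_zero_iff_norm_tendsto_zero]
      refine squeeze_zero' (Eventually.of_forall fun p => norm_nonneg _) ?_ hrem
      filter_upwards [hsmall, hkF.eventually_gt_atTop 0] with p hp hpk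
      have hk0 : (0 : ℝ) < k p.1 := by exact_mod_cast hpk
      have hsq : 0 < √(k p.1 : ℝ) := Real.sqrt_pos.2 hk0
      have hss : √(k p.1 : ℝ) * √(k p.1 : ℝ) = k p.1 := Real.mul_self_sqrt hk0.le
      have hT := norm_integral_exp_sub_taylor_le (L[|{x | p.2 < ‖x‖}]) (hZm p.1)
        (inv_nonneg.2 hsq.le) (hZM p.1 p.2) hp
      rw [hEZ] at hT
      have e1 : (k p.1 : ℝ) * ((√(k p.1 : ℝ))⁻¹ * (m p.2 - a p.1)) =
          √(k p.1) * (m p.2 - a p.1) := by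
        rw [← hss, Real.sqrt_mul_self hsq.le]
        field_simp
      have e2 : (k p.1 : ℝ) * ((√(k p.1 : ℝ))⁻¹ ^ 2 *
          (∫ x, Z p.1 x ^ 2 ∂(L[|{x | p.2 < ‖x‖}])) / 2) =
          (∫ x, Z p.1 x ^ 2 ∂(L[|{x | p.2 < ‖x‖}])) / 2 := by
        rw [inv_pow, Real.sq_sqrt hk0.le]
        field_simp
      rw [← e1, ← e2]
      have e3 : ∀ u w z : ℝ, (k p.1 : ℂ) * (ψ p - 1) -
          (((k p.1 * u : ℝ) : ℂ) * Complex.I - ((k p.1 * w : ℝ) : ℂ)) =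
          k p.1 * (ψ p - (1 + (u : ℂ) * Complex.I - (w : ℂ))) := by
        intro u w z
        push_cast
        ring
      rw [e3 _ _ 0, norm_mul, Complex.norm_natCast]
      calc (k p.1 : ℝ) * _ ≤ k p.1 * ((√(k p.1 : ℝ))⁻¹ * (2 * M)) ^ 3 := by gcongr
        _ = (2 * M) ^ 3 * (√(k p.1 : ℝ))⁻¹ := by
          rw [← hss, Real.sqrt_mul_self hsq.le]
          field_simp
    have := hdiff.add hprinc
    rw [zero_add] at this
    refine this.congr fun p => ?_
    ring
  have hfinal := tendsto_pow_exp_neg hkF (Eventually.of_forall hψ1)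
    (div_nonneg (variance_nonneg v (limitModel μ)) two_pos.le) hmain
  have hev := (tendsto_iff_norm_sub_tendsto_zero.1 hfinal).eventually (gt_mem_nhds hη)
  rw [hF, eventually_inf_principal, prod_top, eventually_comap] at hev
  filter_upwards [hev] with n hn s hs
  exact (hn (n, s) rfl hs).le

end IsRegularlyVarying

/-! ### Limit of the characteristic function of the statistic -/

/-- Without ties at the threshold exactly `k` terms are present, so the centering `a` can be
distributed over them and the exponential of the sum factorizes. -/
theorem exp_top_sum_eq_prod {E : Type*} {n k : ℕ} (hkn : k < n) (hk : 0 < k) (R v : E → ℝ) (a : ℝ)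
    (x : Fin n → E) (hties : ∀ i j, i ≠ j → R (x i) = R (x j) →
      R (x j) ≠ upperOrderStat n k fun i => R (x i)) :
    Complex.exp (((√k * ((k : ℝ)⁻¹ * (∑ i, if upperOrderStat n k (fun i => R (x i)) < R (x i)
      then v (x i) else 0) - a) : ℝ) : ℂ) * Complex.I) =
    ∏ i, if upperOrderStat n k (fun i => R (x i)) < R (x i)
      then Complex.exp ((((√k)⁻¹ * (v (x i) - a) : ℝ) : ℂ) * Complex.I) else 1 := by
  obtain ⟨j, hj⟩ := exists_upperOrderStat_eq hkn fun i => R (x i)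
  have hcard := card_gt_upperOrderStat_eq hkn (fun i => R (x i)) j hj
    fun i hij he => hties i j hij he hj.symm
  simp only [← hj] at hcard
  have hk' : (0 : ℝ) < k := Nat.cast_pos.2 hk
  have hsq : 0 < √(k : ℝ) := Real.sqrt_pos.2 hk'
  set T := upperOrderStat n k fun i => R (x i) with hT
  have hsum : √k * ((k : ℝ)⁻¹ * (∑ i, if T < R (x i) then v (x i) else 0) - a) =
      ∑ i, if T < R (x i) then (√k)⁻¹ * (v (x i) - a) else 0 := by
    rw [← Finset.sum_filter, ← Finset.sum_filter, ← Finset.mul_sum, Finset.sum_sub_distrib,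
      Finset.sum_const, hcard, nsmul_eq_mul]
    have hss : √(k : ℝ) * √(k : ℝ) = k := Real.mul_self_sqrt hk'.le
    rw [← hss, Real.sqrt_mul_self hsq.le]
    field_simp
  rw [hsum, Complex.ofReal_sum, Finset.sum_mul, Complex.exp_sum]
  refine Finset.prod_congr rfl fun i _ => ?_
  split_ifs <;> simp

namespace IsRegularlyVarying

variable {d : ℕ} {L μ : Measure (EuclideanSpace ℝ (Fin d))} [IsProbabilityMeasure L] {k : ℕ → ℕ}

/-- The characteristic function of a normalized linear functional of the empirical moments converges
to that of a centered Gaussian variable. -/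
theorem tendsto_integral_exp_empirical (h : IsRegularlyVarying L id μ)
    {ω : EuclideanSpace ℝ (Fin d) → ℝ} (hω : Measurable ω) (hωhom : AsymptoticallyHomogeneous ω μ)
    {C : ℝ} (hC : ∀ᵐ x ∂L, ‖rescale ω x‖ ≤ C) {f : EuclideanSpace ℝ (Fin d) → ℝ}
    (hf : Continuous f) (hk : Tendsto k atTop atTop)
    (hkn : Tendsto (fun n => (k n : ℝ) / n) atTop (𝓝 0)) {r₀ : ℝ}
    (hcont : ∀ r, r₀ ≤ r → L {x | ‖x‖ = r} = 0) {ε : ℝ} (hε : 0 < ε)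
    (hbias : ∀ δ : ℝ, 0 < δ → ∀ᶠ n in atTop, ∀ s ∈ Set.Icc (1 - ε) (1 + ε),
      |∫ x, f (rescale ω x) ∂(L[|{x | s * tailQuantile L id n (k n) < ‖x‖}]) -
        ∫ x, f (rescale ω x) ∂(L[|{x | tailQuantile L id n (k n) < ‖x‖}])| ≤ δ * (√(k n))⁻¹) :
    Tendsto (fun n => ∫ x : Fin n → EuclideanSpace ℝ (Fin d),
      Complex.exp (((√(k n) * ((k n : ℝ)⁻¹ * (∑ i,
        if upperOrderStat n (k n) (fun i => ‖x i‖) < ‖x i‖ then f (rescale ω (x i)) else 0) -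
        ∫ x, f (rescale ω x) ∂(L[|{x | tailQuantile L id n (k n) < ‖x‖}])) : ℝ) : ℂ) * Complex.I)
        ∂(Measure.pi fun _ => L)) atTop
      (𝓝 (Complex.exp (-(Var[fun x => f (rescale ω x); limitModel μ] / 2 : ℝ)))) := by
  set q : ℕ → ℝ := fun n => tailQuantile L id n (k n) with hq
  have hqlim : Tendsto q atTop atTop := h.tendsto_tailQuantile hk hkn
  -- The given window may contain nonpositive multiples of the quantile; shrinking it keeps all
  -- thresholds going to infinity.
  set ε' := min ε (1 / 2) with hε'
  have hε'0 : 0 < ε' := lt_min hε (by norm_num)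
  have hε'1 : ε' < 1 := (min_le_right _ _).trans_lt (by norm_num)
  have hε'ε : ε' ≤ ε := min_le_left _ _
  have hbias' : ∀ δ : ℝ, 0 < δ → ∀ᶠ n in atTop, ∀ s ∈ Set.Icc (1 - ε') (1 + ε'),
      |∫ x, f (rescale ω x) ∂(L[|{x | s * q n < ‖x‖}]) -
        ∫ x, f (rescale ω x) ∂(L[|{x | q n < ‖x‖}])| ≤ δ * (√(k n))⁻¹ := by
    intro δ hδ
    filter_upwards [hbias δ hδ] with n hn s hs
    exact hn s ⟨by linarith [hs.1], by linarith [hs.2]⟩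
  set v : EuclideanSpace ℝ (Fin d) → ℝ := fun x => f (rescale ω x) with hv
  have hvm : Measurable v := hf.measurable.comp (measurable_rescale hω)
  set c : ℂ := Complex.exp (-(Var[v; limitModel μ] / 2 : ℝ)) with hc
  have hc1 : ‖c‖ ≤ 1 := by
    rw [hc, ← Complex.ofReal_neg, Complex.norm_exp_ofReal, Real.exp_le_one_iff, neg_nonpos]
    exact div_nonneg (variance_nonneg _ _) two_pos.le
  have hN := h.tendsto_upperOrderStat_mem hk hkn hcont hε'0 hε'1
  rw [Metric.tendsto_nhds]
  intro η hη
  have hη3 : 0 < η / 3 := by linarith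
  -- The event of a threshold outside the window costs twice its probability two times: in replacing
  -- the sum by the product and in averaging the powers. With η/12 the total is at most η/3 + 4·η/12
  -- < η.
  filter_upwards [h.eventually_norm_condCharFun_pow_sub_le hω hωhom hC hf hk hqlim hε'1 hbias' hη3,
    hN.eventually (gt_mem_nhds (show 0 < η / 12 by linarith)),
    (hqlim.const_mul_atTop (show 0 < 1 - ε' by linarith)).eventually_ge_atTop r₀,
    hkn.eventually (gt_mem_nhds one_pos), hk.eventually_gt_atTop 0, eventually_gt_atTop 0]
    with n hchar hNn hqr hkn1 hk0 hn0
  have hkltn : k n < n := by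
    rw [div_lt_one (Nat.cast_pos.2 hn0)] at hkn1
    exact_mod_cast hkn1
  set I := Set.Icc ((1 - ε') * q n) ((1 + ε') * q n) with hI
  set Q : Measure (Fin n → EuclideanSpace ℝ (Fin d)) := Measure.pi fun _ => L with hQ
  set a := ∫ x, v x ∂(L[|{x | q n < ‖x‖}]) with ha
  set g : EuclideanSpace ℝ (Fin d) → ℂ := fun x =>
    Complex.exp ((((√(k n))⁻¹ * (v x - a) : ℝ) : ℂ) * Complex.I) with hg
  have hgm : Measurable g := Complex.measurable_exp.comp ((Complex.measurable_ofReal.comp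
    ((hvm.sub_const a).const_mul _)).mul_const _)
  have hg1 : ∀ x, ‖g x‖ ≤ 1 := fun x => (Complex.norm_exp_ofReal_mul_I _).le
  set T : (Fin n → EuclideanSpace ℝ (Fin d)) → ℝ := fun x =>
    upperOrderStat n (k n) fun i => ‖x i‖ with hT
  have hTm : Measurable T := (measurable_upperOrderStat _ _).comp (measurable_pi_lambda _ fun i =>
    measurable_norm.comp (measurable_pi_apply i))
  set N₀ := {x | T x ∉ I} with hN₀
  have hN₀m : MeasurableSet N₀ := (hTm measurableSet_Icc).compl
  set D := {x : Fin n → EuclideanSpace ℝ (Fin d) |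
    ∃ i j, i ≠ j ∧ ‖x i‖ = ‖x j‖ ∧ r₀ ≤ ‖x j‖} with hD
  have hD0 : Q D = 0 := measure_pi_ties_eq_zero L measurable_norm hcont n
  have hgood : ∀ x ∉ N₀ ∪ D, T x ∈ I ∧ ∀ i j, i ≠ j → ‖x i‖ = ‖x j‖ → ‖x j‖ ≠ T x := by
    intro x hx
    simp only [Set.mem_union, not_or] at hx
    have hxI : T x ∈ I := not_not.1 hx.1
    refine ⟨hxI, fun i j hij he hjT => hx.2 ⟨i, j, hij, he, ?_⟩⟩
    rw [hjT]
    exact hqr.trans hxI.1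
  have hH : ∀ s ∈ I, ‖(∫ z in {z | s < ‖z‖}, g z ∂L) ^ k n -
      c * (L.real {z | s < ‖z‖} : ℂ) ^ k n‖ ≤ η / 3 * L.real {z | s < ‖z‖} ^ k n := by
    intro s hs
    have hpos := h.tail_pos s
    have hcondint : ∫ z in {z | s < ‖z‖}, g z ∂L =
        (L.real {z | s < ‖z‖} : ℂ) * ∫ z, g z ∂(L[|{z | s < ‖z‖}]) := by
      rw [ProbabilityTheory.cond, integral_smul_measure, ENNReal.toReal_inv, ← measureReal_def,
        Complex.real_smul, Complex.ofReal_inv, ← mul_assoc,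
        mul_inv_cancel₀ (Complex.ofReal_ne_zero.2 hpos.ne'), one_mul]
    rw [hcondint, mul_pow, mul_comm c, ← mul_sub, norm_mul, norm_pow, Complex.norm_real,
      Real.norm_of_nonneg hpos.le, mul_comm]
    exact mul_le_mul_of_nonneg_right (hchar s hs) (by positivity)
  have hmain := norm_integral_prod_top_sub_le L measurable_norm measurableSet_Icc hgm hg1 hkltn hc1
    hη3.le hH (N := N₀ ∪ D) hgood
  set W : (Fin n → EuclideanSpace ℝ (Fin d)) → ℂ := fun x =>
    ∏ i, if T x < ‖x i‖ then g (x i) else 1 with hW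
  have hQN : Q.real (N₀ ∪ D) ≤ Q.real N₀ := by
    refine (measureReal_union_le _ _).trans ?_
    rw [measureReal_def (s := D), hD0]
    simp
  have hWm : Measurable W := Finset.measurable_prod _ fun i _ => Measurable.ite (measurableSet_lt hTm
    (measurable_norm.comp (measurable_pi_apply i))) (hgm.comp (measurable_pi_apply i))
    measurable_const
  have hW1 : ∀ x, ‖W x‖ ≤ 1 := by
    intro x
    rw [hW, norm_prod]
    refine Finset.prod_le_one (fun _ _ => norm_nonneg _) fun i _ => ?_
    split_ifs
    · exact hg1 _
    · simp
  set Y : (Fin n → EuclideanSpace ℝ (Fin d)) → ℂ := fun x =>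
    Complex.exp (((√(k n) * ((k n : ℝ)⁻¹ * (∑ i, if T x < ‖x i‖ then v (x i) else 0) - a) : ℝ) : ℂ) *
      Complex.I) with hY
  have hYm : Measurable Y := by
    refine Complex.measurable_exp.comp ((Complex.measurable_ofReal.comp (((Measurable.const_mul
      (Finset.measurable_fun_sum _ fun i _ => Measurable.ite (measurableSet_lt hTm
      (measurable_norm.comp (measurable_pi_apply i))) (hvm.comp (measurable_pi_apply i))
      measurable_const) _).sub_const a).const_mul _)).mul_const _)
  have hY1 : ∀ x, ‖Y x‖ ≤ 1 := fun x => (Complex.norm_exp_ofReal_mul_I _).le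
  have hdiff : ‖∫ x, Y x ∂Q - ∫ x, W x ∂Q‖ ≤ 2 * Q.real N₀ := by
    rw [← integral_sub (Integrable.of_bound hYm.aestronglyMeasurable 1 (Eventually.of_forall hY1))
      (Integrable.of_bound hWm.aestronglyMeasurable 1 (Eventually.of_forall hW1))]
    have hind : ∫ x, N₀.indicator (fun _ => (2 : ℝ)) x ∂Q = 2 * Q.real N₀ := by
      rw [integral_indicator_const _ hN₀m, smul_eq_mul, mul_comm]
    rw [← hind]
    refine norm_integral_le_of_norm_le ((integrable_const 2).indicator hN₀m) ?_
    have hDae : ∀ᵐ x ∂Q, x ∉ D := measure_eq_zero_iff_ae_notMem.1 hD0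
    filter_upwards [hDae] with x hxD
    by_cases hx : x ∈ N₀
    · rw [Set.indicator_of_mem hx]
      exact (norm_sub_le _ _).trans (by linarith [hY1 x, hW1 x])
    · rw [Set.indicator_of_notMem hx]
      have : Y x = W x := exp_top_sum_eq_prod hkltn hk0 norm v a x
        (hgood x (by simp [hx, hxD])).2
      rw [this, sub_self, norm_zero]
  rw [dist_eq_norm]
  have htri : ‖∫ x, Y x ∂Q - c‖ ≤ ‖∫ x, Y x ∂Q - ∫ x, W x ∂Q‖ + ‖∫ x, W x ∂Q - c‖ :=
    norm_sub_le_norm_sub_add_norm_sub _ _ _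
  have hm' : ‖∫ x, W x ∂Q - c‖ ≤ η / 3 + 2 * Q.real (N₀ ∪ D) := hmain
  have hNn' : Q.real N₀ < η / 12 := hNn
  change ‖∫ x, Y x ∂Q - c‖ < η
  linarith

end IsRegularlyVarying

/-! ### The Gaussian limit matrix -/

/-- This matches the exponent of the multivariate Gaussian with the variance produced by the
one-dimensional limit. -/
theorem dotProduct_covariance_mulVec {α ι : Type*} [MeasurableSpace α] [Fintype ι] (ρ : Measure α)
    [IsProbabilityMeasure ρ] {Y : ι → α → ℝ} (hY : ∀ p, MemLp (Y p) 2 ρ) (u : ι → ℝ) :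
    dotProduct u ((Matrix.of fun p q => cov[Y p, Y q; ρ]).mulVec u) =
      Var[fun x => ∑ p, u p * Y p x; ρ] := by
  have hY' : ∀ p, MemLp (fun x => u p * Y p x) 2 ρ := fun p => (hY p).const_mul (u p)
  rw [variance_fun_sum hY']
  simp only [dotProduct, Matrix.mulVec, Matrix.of_apply, Finset.mul_sum,
    covariance_const_mul_left, covariance_const_mul_right]
  exact Finset.sum_congr rfl fun p _ => Finset.sum_congr rfl fun q _ => by ring

theorem posSemidef_covariance {α ι : Type*} [MeasurableSpace α] [Fintype ι] (ρ : Measure α)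
    [IsProbabilityMeasure ρ] {Y : ι → α → ℝ} (hY : ∀ p, MemLp (Y p) 2 ρ) :
    (Matrix.of fun p q => cov[Y p, Y q; ρ]).PosSemidef := by
  refine Matrix.PosSemidef.of_dotProduct_mulVec_nonneg ?_ fun u => ?_
  · ext p q
    simp [covariance_comm]
  · rw [star_trivial, dotProduct_covariance_mulVec ρ hY]
    exact variance_nonneg _ _

/-- Vectors indexed by pairs, read as square matrices. -/
def matrixOfVector (d : ℕ) : EuclideanSpace ℝ (Fin d × Fin d) →L[ℝ] Matrix (Fin d) (Fin d) ℝ where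
  toFun x := Matrix.of fun i j => x (i, j)
  map_add' _ _ := rfl
  map_smul' _ _ := rfl
  cont := by
    refine continuous_pi fun i => continuous_pi fun j => ?_
    change Continuous fun x : EuclideanSpace ℝ (Fin d × Fin d) => x (i, j)
    fun_prop

theorem measurable_matrixOfVector (d : ℕ) : Measurable (matrixOfVector d) :=
  (matrixOfVector d).continuous.measurable

theorem measurable_matrix_entry {d : ℕ} (i j : Fin d) :
    Measurable fun U : Matrix (Fin d) (Fin d) ℝ => U i j :=
  (measurable_pi_apply j).comp (measurable_pi_apply (X := fun _ : Fin d => Fin d → ℝ) i)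

theorem gaussianMatrix_properties {d : ℕ} {S : Matrix (Fin d × Fin d) (Fin d × Fin d) ℝ}
    (hS : S.PosSemidef) (hsymm : ∀ i j p, S (i, j) p = S (j, i) p) :
    IsGaussian ((multivariateGaussian 0 S).map (matrixOfVector d)) ∧
      (∀ᵐ U ∂((multivariateGaussian 0 S).map (matrixOfVector d)), U.IsSymm) ∧
      (∀ i j, ∫ U, U i j ∂((multivariateGaussian 0 S).map (matrixOfVector d)) = 0) ∧
      ∀ i j l m, cov[fun U => U i j, fun U => U l m;
        (multivariateGaussian 0 S).map (matrixOfVector d)] = S (i, j) (l, m) := by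
  have hm := measurable_matrixOfVector d
  have hmem : ∀ p, MemLp (fun x : EuclideanSpace ℝ (Fin d × Fin d) => x p) 2
      (multivariateGaussian 0 S) := fun p =>
    IsGaussian.memLp_dual (multivariateGaussian 0 S) (EuclideanSpace.proj p) 2 (by simp)
  have hmean : ∀ p, ∫ x, x p ∂(multivariateGaussian 0 S) = 0 := by
    intro p
    have := (EuclideanSpace.proj (𝕜 := ℝ) p).integral_comp_id_comm
      (IsGaussian.integrable_id (μ := multivariateGaussian (0 : EuclideanSpace ℝ _) S))
    simpa using this
  have hscomm : ∀ p q, S p q = S q p := fun p q => by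
    have := hS.isHermitian.apply p q
    simpa using this.symm
  refine ⟨isGaussian_map_of_measurable hm, ?_, fun i j => ?_, fun i j l m => ?_⟩
  · rw [ae_map_iff hm.aemeasurable]
    · have hij : ∀ i j : Fin d, ∀ᵐ x ∂(multivariateGaussian 0 S), x (i, j) = x (j, i) := by
        intro i j
        -- Equal rows of `S` make the difference of mirrored coordinates a variable of variance
        -- zero, hence almost surely equal to its mean 0.
        have hvar : Var[fun x : EuclideanSpace ℝ (Fin d × Fin d) => x (i, j) - x (j, i);
            multivariateGaussian 0 S] = 0 := by
          rw [variance_fun_sub (hmem _) (hmem _), variance_eval_multivariateGaussian hS,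
            variance_eval_multivariateGaussian hS, covariance_eval_multivariateGaussian hS,
            hsymm i j (i, j), hsymm i j (j, i), hscomm (j, i) (i, j), hsymm i j (j, i)]
          ring
        have hz := ae_eq_integral_of_variance_eq_zero ((hmem (i, j)).sub (hmem (j, i))) hvar
        filter_upwards [hz] with x hx
        have hint : ∫ x : EuclideanSpace ℝ (Fin d × Fin d), (x (i, j) - x (j, i))
            ∂(multivariateGaussian 0 S) = 0 := by
          rw [integral_sub ((hmem _).integrable one_le_two) ((hmem _).integrable one_le_two),
            hmean, hmean, sub_zero]
        have hx' : x (i, j) - x (j, i) = ∫ x : EuclideanSpace ℝ (Fin d × Fin d),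
            (x (i, j) - x (j, i)) ∂(multivariateGaussian 0 S) := hx
        rw [hint] at hx'
        linarith
      have hall : ∀ᵐ x ∂(multivariateGaussian 0 S), ∀ i j : Fin d, x (i, j) = x (j, i) :=
        ae_all_iff.2 fun i => ae_all_iff.2 fun j => hij i j
      filter_upwards [hall] with x hx
      ext i j
      exact hx j i
    · have : {U : Matrix (Fin d) (Fin d) ℝ | U.IsSymm} = ⋂ i, ⋂ j, {U | U j i = U i j} := by
        ext U
        simp [Matrix.IsSymm.ext_iff]
      rw [this]
      exact MeasurableSet.iInter fun i => MeasurableSet.iInter fun j =>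
        measurableSet_eq_fun (measurable_matrix_entry j i) (measurable_matrix_entry i j)
  · rw [integral_map hm.aemeasurable (measurable_matrix_entry i j).aestronglyMeasurable]
    exact hmean (i, j)
  · rw [covariance_map_fun (measurable_matrix_entry i j).aestronglyMeasurable
      (measurable_matrix_entry l m).aestronglyMeasurable hm.aemeasurable]
    exact covariance_eval_multivariateGaussian hS (i, j) (l, m)

theorem abs_apply_le_opNorm {d : ℕ} (A : Matrix (Fin d) (Fin d) ℝ) (i j : Fin d) :
    |A i j| ≤ opNorm A := by
  have h1 : A i j = Matrix.toEuclideanCLM (n := Fin d) (𝕜 := ℝ) A (EuclideanSpace.single j 1) i := by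
    rw [Matrix.ofLp_toEuclideanCLM]
    simp
  rw [h1, ← Real.norm_eq_abs]
  refine (PiLp.norm_apply_le _ i).trans ((ContinuousLinearMap.le_opNorm _ _).trans ?_)
  rw [PiLp.norm_single, norm_one, mul_one]
  rfl

/-! ### Reduction to the law of X and to quadratic forms -/

section Law

variable {Ω : Type*} [MeasurableSpace Ω] {P : Measure Ω} {d : ℕ}
  {X : Ω → EuclideanSpace ℝ (Fin d)} {μ : Measure (EuclideanSpace ℝ (Fin d))}

/-- Regular variation, the quantile and the conditional moments depend only on the law of `X`, so
the analysis can take place on the Euclidean space with `id` as the random vector. -/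
theorem IsRegularlyVarying.map (h : IsRegularlyVarying P X μ) (hX : Measurable X) :
    IsRegularlyVarying (P.map X) id μ where
  measure_zero := h.measure_zero
  nondegenerate := h.nondegenerate
  finite_away := h.finite_away
  tendsto B hB h0 hfr := by
    refine (h.tendsto B hB h0 hfr).congr fun t => ?_
    have h1 : (P.map X) {x | t⁻¹ • id x ∈ B} = P {w | t⁻¹ • X w ∈ B} :=
      Measure.map_apply hX ((measurable_id.const_smul t⁻¹) hB)
    have h2 : (P.map X) {x | t < ‖id x‖} = P {w | t < ‖X w‖} :=
      Measure.map_apply hX (IsRegularlyVarying.measurableSet_norm_gt t)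
    rw [h1, h2]

theorem tailQuantile_map (hX : Measurable X) (n k : ℕ) :
    tailQuantile (P.map X) id n k = tailQuantile P X n k := by
  have : ∀ r : ℝ, (P.map X).real {x | ‖id x‖ ≤ r} = P.real {w | ‖X w‖ ≤ r} := fun r =>
    map_measureReal_apply hX (measurableSet_le measurable_norm measurable_const)
  simp only [tailQuantile, this]

theorem cond_map (hX : Measurable X) (t : ℝ) :
    (P.map X)[|{x | t < ‖x‖}] = (P[|{w | t < ‖X w‖}]).map X := by
  have hA := IsRegularlyVarying.measurableSet_norm_gt (d := d) t
  rw [ProbabilityTheory.cond, ProbabilityTheory.cond, Measure.map_smul, Measure.restrict_map hX hA,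
    Measure.map_apply hX hA]
  rfl

theorem condMoment_apply {ω : EuclideanSpace ℝ (Fin d) → ℝ} (hω : Measurable ω)
    (hX : Measurable X) (t : ℝ) (i j : Fin d) :
    condMoment P ω X t i j =
      ∫ x, rescale ω x i * rescale ω x j ∂((P.map X)[|{x | t < ‖x‖}]) := by
  have hθ := measurable_rescale hω
  rw [cond_map hX, integral_map hX.aemeasurable]
  · rfl
  · have hi : ∀ i, Measurable fun x => rescale ω x i := fun i =>
      (EuclideanSpace.proj (𝕜 := ℝ) i).continuous.measurable.comp hθ
    exact ((hi i).mul (hi j)).aestronglyMeasurable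

end Law

theorem empMoment_apply {Ω : Type*} {d : ℕ} (ω : EuclideanSpace ℝ (Fin d) → ℝ)
    (X : ℕ → Ω → EuclideanSpace ℝ (Fin d)) (n k : ℕ) (w : Ω) (a b : Fin d) :
    empMoment ω X n k w a b = (k : ℝ)⁻¹ * ∑ i : Fin n,
      if upperOrderStat n k (fun i => ‖X i w‖) < ‖X i w‖ then
        rescale ω (X i w) a * rescale ω (X i w) b else 0 := by
  rw [empMoment, Matrix.smul_apply, Matrix.sum_apply, smul_eq_mul]
  congr 1
  refine Finset.sum_congr rfl fun i _ => ?_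
  rw [Set.indicator_apply]
  by_cases hi : upperOrderStat n k (fun i => ‖X i w‖) < ‖X i w‖
  · rw [if_pos hi, if_pos (show w ∈ {v | empThreshold X n k v < ‖X i v‖} from hi)]
    rfl
  · rw [if_neg hi, if_neg (show w ∉ {v | empThreshold X n k v < ‖X i v‖} from hi)]
    rfl

section QuadraticForm

variable {d : ℕ}

/-- The quadratic form `y ↦ ∑ u_{ij} y_i y_j`. -/
noncomputable def quadraticSum (u : Fin d × Fin d → ℝ) (y : EuclideanSpace ℝ (Fin d)) : ℝ :=
  ∑ p, u p * (y p.1 * y p.2)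

theorem continuous_quadraticSum (u : Fin d × Fin d → ℝ) : Continuous (quadraticSum u) := by
  unfold quadraticSum
  fun_prop

theorem measurable_rescale_mul {ω : EuclideanSpace ℝ (Fin d) → ℝ} (hω : Measurable ω)
    (i j : Fin d) : Measurable fun x => rescale ω x i * rescale ω x j := by
  have hθ := measurable_rescale hω
  have hi : ∀ i, Measurable fun x => rescale ω x i := fun i =>
    (EuclideanSpace.proj (𝕜 := ℝ) i).continuous.measurable.comp hθ
  exact (hi i).mul (hi j)

theorem memLp_rescale_mul {ω : EuclideanSpace ℝ (Fin d) → ℝ} (hω : Measurable ω) {C : ℝ}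
    {ρ : Measure (EuclideanSpace ℝ (Fin d))} [IsFiniteMeasure ρ]
    (hC : ∀ᵐ x ∂ρ, ‖rescale ω x‖ ≤ C) (i j : Fin d) (r : ENNReal) :
    MemLp (fun x => rescale ω x i * rescale ω x j) r ρ := by
  refine MemLp.of_bound (measurable_rescale_mul hω i j).aestronglyMeasurable (C * C) ?_
  filter_upwards [hC] with x hx
  have h : ∀ i, ‖rescale ω x i‖ ≤ C := fun i => (PiLp.norm_apply_le _ i).trans hx
  rw [norm_mul]
  exact mul_le_mul (h i) (h j) (norm_nonneg _) ((norm_nonneg _).trans hx)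

theorem integral_quadraticSum_rescale {ω : EuclideanSpace ℝ (Fin d) → ℝ} (hω : Measurable ω)
    {C : ℝ} {ρ : Measure (EuclideanSpace ℝ (Fin d))} [IsFiniteMeasure ρ]
    (hC : ∀ᵐ x ∂ρ, ‖rescale ω x‖ ≤ C) (u : Fin d × Fin d → ℝ) :
    ∫ x, quadraticSum u (rescale ω x) ∂ρ =
      ∑ p, u p * ∫ x, rescale ω x p.1 * rescale ω x p.2 ∂ρ := by
  unfold quadraticSum
  rw [integral_finsetSum]
  · simp only [integral_const_mul]
  · intro p _
    exact (memLp_one_iff_integrable.1 (memLp_rescale_mul hω hC p.1 p.2 1)).const_mul (u p)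

end QuadraticForm

/-- The normalized estimation error, as a Euclidean vector indexed by pairs. -/
noncomputable def errorVector {Ω : Type*} [MeasurableSpace Ω] {d : ℕ} (P : Measure Ω)
    (ω : EuclideanSpace ℝ (Fin d) → ℝ) (X : ℕ → Ω → EuclideanSpace ℝ (Fin d)) (n k : ℕ) (w : Ω) :
    EuclideanSpace ℝ (Fin d × Fin d) :=
  WithLp.toLp 2 fun p => √k * (empMoment ω X n k w p.1 p.2 -
    condMoment P ω (X 0) (tailQuantile P (X 0) n k) p.1 p.2)

section ErrorVector

variable {Ω : Type*} [MeasurableSpace Ω] {P : Measure Ω} {d : ℕ}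
  {X : ℕ → Ω → EuclideanSpace ℝ (Fin d)} {ω : EuclideanSpace ℝ (Fin d) → ℝ}

theorem measurable_errorVector (hX : ∀ i, Measurable (X i)) (hω : Measurable ω) (n k : ℕ) :
    Measurable (errorVector P ω X n k) := by
  refine (WithLp.measurable_toLp 2 _).comp (measurable_pi_lambda _ fun p => ?_)
  refine Measurable.const_mul (Measurable.sub_const ?_ _) _
  simp only [empMoment_apply]
  have hset : ∀ i : Fin n, MeasurableSet
      {w | upperOrderStat n k (fun i => ‖X i w‖) < ‖X i w‖} := fun i =>
    measurableSet_lt ((measurable_upperOrderStat n k).comp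
      (measurable_pi_lambda (fun w (i : Fin n) => ‖X i w‖) fun i => (hX i).norm)) (hX i).norm
  exact Measurable.const_mul (Finset.measurable_fun_sum Finset.univ fun (i : Fin n) _ =>
    Measurable.ite (hset i) ((measurable_rescale_mul hω p.1 p.2).comp (hX i)) measurable_const) _

variable [IsProbabilityMeasure P]

theorem inner_errorVector (hX : ∀ i, Measurable (X i)) (hω : Measurable ω) {C : ℝ}
    (hC : ∀ᵐ x ∂(P.map (X 0)), ‖rescale ω x‖ ≤ C) (n k : ℕ) (u : EuclideanSpace ℝ (Fin d × Fin d))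
    (w : Ω) :
    inner ℝ (errorVector P ω X n k w) u =
      √k * ((k : ℝ)⁻¹ * (∑ i : Fin n, if upperOrderStat n k (fun i => ‖X i w‖) < ‖X i w‖ then
        quadraticSum u (rescale ω (X i w)) else 0) -
        ∫ x, quadraticSum u (rescale ω x)
          ∂((P.map (X 0))[|{x | tailQuantile (P.map (X 0)) id n k < ‖x‖}])) := by
  have := Measure.isProbabilityMeasure_map (μ := P) (hX 0).aemeasurable
  rw [integral_quadraticSum_rescale hω (cond_absolutelyContinuous.ae_le hC),
    tailQuantile_map (hX 0), PiLp.inner_apply]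
  simp only [errorVector, empMoment_apply, condMoment_apply hω (hX 0), RCLike.inner_apply,
    conj_trivial]
  have hsum : (∑ i : Fin n, if upperOrderStat n k (fun i => ‖X i w‖) < ‖X i w‖ then
      quadraticSum u (rescale ω (X i w)) else 0) = ∑ p, u p * ∑ i : Fin n,
      if upperOrderStat n k (fun i => ‖X i w‖) < ‖X i w‖ then
        rescale ω (X i w) p.1 * rescale ω (X i w) p.2 else 0 := by
    simp only [Finset.mul_sum]
    rw [Finset.sum_comm]
    refine Finset.sum_congr rfl fun i _ => ?_
    split_ifs
    · rfl
    · simp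
  rw [hsum, Finset.mul_sum, ← Finset.sum_sub_distrib, Finset.mul_sum]
  exact Finset.sum_congr rfl fun p _ => by ring

/-- Independence and identical distribution turn the law of the sample into a product measure, where
the Fubini argument applies; the pairing with `u` is the same statistic for the quadratic form of
`u`. -/
theorem charFun_errorVector (hX : ∀ i, Measurable (X i)) (hindep : iIndepFun X P)
    (hident : ∀ i, IdentDistrib (X i) (X 0) P P) (hω : Measurable ω) {C : ℝ}
    (hC : ∀ᵐ x ∂(P.map (X 0)), ‖rescale ω x‖ ≤ C) (n k : ℕ)
    (u : EuclideanSpace ℝ (Fin d × Fin d)) :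
    charFun (P.map (errorVector P ω X n k)) u =
      ∫ x : Fin n → EuclideanSpace ℝ (Fin d),
      Complex.exp (((√k * ((k : ℝ)⁻¹ * (∑ i,
        if upperOrderStat n k (fun i => ‖x i‖) < ‖x i‖ then quadraticSum u (rescale ω (x i)) else 0) -
        ∫ x, quadraticSum u (rescale ω x)
          ∂((P.map (X 0))[|{x | tailQuantile (P.map (X 0)) id n k < ‖x‖}])) : ℝ) : ℂ) * Complex.I)
        ∂(Measure.pi fun _ => P.map (X 0)) := by
  have hlaw : (Measure.pi fun _ : Fin n => P.map (X 0)) = P.map fun w (i : Fin n) => X i w := by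
    rw [(iIndepFun_iff_map_fun_eq_pi_map (f := fun (i : Fin n) => X i)
      fun i => (hX i).aemeasurable).1 (hindep.precomp Fin.val_injective)]
    congr 1
    funext i
    exact (hident i).map_eq.symm
  have hvm : Measurable fun x => quadraticSum u (rescale ω x) :=
    (continuous_quadraticSum u).measurable.comp (measurable_rescale hω)
  rw [charFun_apply, integral_map (measurable_errorVector hX hω n k).aemeasurable (by fun_prop),
    hlaw, integral_map (measurable_pi_lambda (fun w (i : Fin n) => X i w) fun i => hX i).aemeasurable]
  · simp only [inner_errorVector hX hω hC]
  · refine (Complex.measurable_exp.comp ((Complex.measurable_ofReal.comp (((Measurable.const_mul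
      (Finset.measurable_fun_sum _ fun i _ => Measurable.ite (measurableSet_lt
      ((measurable_upperOrderStat _ _).comp (measurable_pi_lambda _ fun i =>
        (measurable_pi_apply i).norm)) (measurable_pi_apply i).norm)
      (hvm.comp (measurable_pi_apply i)) measurable_const) _).sub_const _).const_mul _)).mul_const
      _)).aestronglyMeasurable

theorem BiasCondition.quadraticSum (hX : ∀ i, Measurable (X i)) (hω : Measurable ω) {C : ℝ}
    (hC : ∀ᵐ x ∂(P.map (X 0)), ‖rescale ω x‖ ≤ C) {k : ℕ → ℕ} (hB : BiasCondition P ω (X 0) k)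
    (u : Fin d × Fin d → ℝ) : ∃ ε : ℝ, 0 < ε ∧ ∀ δ : ℝ, 0 < δ → ∀ᶠ n in atTop,
      ∀ s ∈ Set.Icc (1 - ε) (1 + ε),
      |∫ x, quadraticSum u (rescale ω x)
          ∂((P.map (X 0))[|{x | s * tailQuantile (P.map (X 0)) id n (k n) < ‖x‖}]) -
        ∫ x, quadraticSum u (rescale ω x)
          ∂((P.map (X 0))[|{x | tailQuantile (P.map (X 0)) id n (k n) < ‖x‖}])| ≤
        δ * (√(k n))⁻¹ := by
  obtain ⟨ε, hε, hbias⟩ := hB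
  have := Measure.isProbabilityMeasure_map (μ := P) (hX 0).aemeasurable
  have hsum0 : 0 ≤ ∑ p, |u p| := Finset.sum_nonneg fun p _ => abs_nonneg _
  refine ⟨ε, hε, fun δ hδ => ?_⟩
  -- Entries are bounded by the operator norm, so the functional costs a factor ∑|u_p|; the added 1
  -- covers `u = 0`.
  filter_upwards [hbias (δ / (∑ p, |u p| + 1)) (by positivity)] with n hn s hs
  rw [integral_quadraticSum_rescale hω (cond_absolutelyContinuous.ae_le hC),
    integral_quadraticSum_rescale hω (cond_absolutelyContinuous.ae_le hC), tailQuantile_map (hX 0)]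
  simp only [← condMoment_apply hω (hX 0)]
  rw [← Finset.sum_sub_distrib]
  set A := condMoment P ω (X 0) (s * tailQuantile P (X 0) n (k n)) -
    condMoment P ω (X 0) (tailQuantile P (X 0) n (k n)) with hA
  have hinv : 0 ≤ (√(k n : ℝ))⁻¹ := by positivity
  calc |∑ p, (u p * condMoment P ω (X 0) (s * tailQuantile P (X 0) n (k n)) p.1 p.2 -
          u p * condMoment P ω (X 0) (tailQuantile P (X 0) n (k n)) p.1 p.2)|
      = |∑ p, u p * A p.1 p.2| := by
        congr 1
        exact Finset.sum_congr rfl fun p _ => by rw [hA, Matrix.sub_apply]; ring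
    _ ≤ ∑ p, |u p * A p.1 p.2| := Finset.abs_sum_le_sum_abs _ _
    _ ≤ ∑ p, |u p| * (δ / (∑ p, |u p| + 1) * (√(k n : ℝ))⁻¹) := by
        refine Finset.sum_le_sum fun p _ => ?_
        rw [abs_mul]
        exact mul_le_mul_of_nonneg_left ((abs_apply_le_opNorm A p.1 p.2).trans (hn s hs))
          (abs_nonneg _)
    _ = (∑ p, |u p|) / (∑ p, |u p| + 1) * (δ * (√(k n : ℝ))⁻¹) := by
        rw [← Finset.sum_mul]
        ring
    _ ≤ 1 * (δ * (√(k n : ℝ))⁻¹) := by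
        refine mul_le_mul_of_nonneg_right ?_ (by positivity)
        rw [div_le_one (by positivity)]
        linarith
    _ = δ * (√(k n : ℝ))⁻¹ := one_mul _

end ErrorVector

/-! ### Convergence in distribution of the matrices -/

theorem mainTheorem1 {Ω : Type*} [MeasurableSpace Ω] (P : Measure Ω) [IsProbabilityMeasure P]
    {d : ℕ} (X : ℕ → Ω → EuclideanSpace ℝ (Fin d)) (hX : ∀ i, Measurable (X i))
    (hindep : iIndepFun X P) (hident : ∀ i, IdentDistrib (X i) (X 0) P P)
    (μ : Measure (EuclideanSpace ℝ (Fin d))) (hrv : IsRegularlyVarying P (X 0) μ)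
    (hcont : ∃ r₀ : ℝ, ∀ r, r₀ ≤ r → P {w | ‖X 0 w‖ = r} = 0)
    (ω : EuclideanSpace ℝ (Fin d) → ℝ) (hω : Measurable ω) (hωpos : ∀ x, 0 < ω x)
    (hωbdd : ∃ C : ℝ, ∀ᵐ w ∂P, ‖rescale ω (X 0 w)‖ ≤ C)
    (hωhom : AsymptoticallyHomogeneous ω μ)
    (k : ℕ → ℕ) (hk : Tendsto k atTop atTop)
    (hkn : Tendsto (fun n => (k n : ℝ) / n) atTop (𝓝 0))
    (hB : BiasCondition P ω (X 0) k) :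
    ∃ (ν : Measure (Matrix (Fin d) (Fin d) ℝ)) (_ : IsProbabilityMeasure ν),
      IsGaussian ν ∧
      (∀ᵐ U ∂ν, U.IsSymm) ∧
      (∀ i j, ∫ U, U i j ∂ν = 0) ∧
      (∀ i j l m, cov[fun U => U i j, fun U => U l m; ν] =
        cov[fun x => rescale ω x i * rescale ω x j, fun x => rescale ω x l * rescale ω x m;
          limitModel μ]) ∧
      TendstoInDistribution
        (fun (n : ℕ) (w : Ω) => Real.sqrt (k n) •
          (empMoment ω X n (k n) w - condMoment P ω (X 0) (tailQuantile P (X 0) n (k n))))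
        atTop id (fun _ => P) ν := by
  obtain ⟨r₀, hr₀⟩ := hcont
  obtain ⟨C, hC⟩ := hωbdd
  set L := P.map (X 0) with hL
  have hLprob : IsProbabilityMeasure L := Measure.isProbabilityMeasure_map (hX 0).aemeasurable
  have hrvL : IsRegularlyVarying L id μ := hrv.map (hX 0)
  have hlim : IsProbabilityMeasure (limitModel μ) := hrvL.isProbabilityMeasure_limitModel
  have hCL : ∀ᵐ x ∂L, ‖rescale ω x‖ ≤ C :=
    (ae_map_iff (hX 0).aemeasurable
      (measurableSet_le (measurable_rescale hω).norm measurable_const)).2 hC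
  have hcontL : ∀ r, r₀ ≤ r → L {x | ‖x‖ = r} = 0 := fun r hr => by
    rw [hL, Measure.map_apply (hX 0) (measurableSet_eq_fun measurable_norm measurable_const)]
    exact hr₀ r hr
  have hmem : ∀ p : Fin d × Fin d,
      MemLp (fun x => rescale ω x p.1 * rescale ω x p.2) 2 (limitModel μ) := fun p =>
    memLp_rescale_mul hω (hrvL.ae_limitModel_norm_rescale_le hω hωhom hCL) p.1 p.2 2
  set S : Matrix (Fin d × Fin d) (Fin d × Fin d) ℝ := Matrix.of fun p q =>
    cov[fun x => rescale ω x p.1 * rescale ω x p.2, fun x => rescale ω x q.1 * rescale ω x q.2;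
      limitModel μ] with hS
  have hSpos : S.PosSemidef := posSemidef_covariance (limitModel μ) hmem
  have hSsymm : ∀ i j p, S (i, j) p = S (j, i) p := fun i j p => by
    simp only [hS, Matrix.of_apply, mul_comm (rescale ω _ i)]
  set G : Measure (EuclideanSpace ℝ (Fin d × Fin d)) := multivariateGaussian 0 S with hG
  have hMm := measurable_matrixOfVector d
  obtain ⟨hg1, hg2, hg3, hg4⟩ := gaussianMatrix_properties hSpos hSsymm
  have hνprob : IsProbabilityMeasure (G.map (matrixOfVector d)) :=
    Measure.isProbabilityMeasure_map hMm.aemeasurable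
  have hYm : ∀ n, Measurable (errorVector P ω X n (k n)) := fun n =>
    measurable_errorVector hX hω n (k n)
  -- Convergence is proved for Euclidean vectors, where characteristic functions are available, and
  -- carried to matrices by the continuous map `matrixOfVector`.
  have hYdist : TendstoInDistribution (fun n => errorVector P ω X n (k n)) atTop id
      (fun _ => P) G := by
    refine ⟨fun n => (hYm n).aemeasurable, aemeasurable_id, ?_⟩
    refine ProbabilityMeasure.tendsto_iff_tendsto_charFun.2 fun u => ?_
    change Tendsto (fun n => charFun (P.map (errorVector P ω X n (k n))) u) atTop
      (𝓝 (charFun (G.map id) u))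
    obtain ⟨ε, hε, hbias⟩ := hB.quadraticSum hX hω hCL u
    have hmain := hrvL.tendsto_integral_exp_empirical hω hωhom hCL (continuous_quadraticSum u) hk hkn
      hcontL hε hbias
    have hlimit : charFun (G.map id) u =
        Complex.exp (-(Var[fun x => quadraticSum u (rescale ω x); limitModel μ] / 2 : ℝ)) := by
      rw [Measure.map_id, hG, charFun_multivariateGaussian hSpos, inner_zero_right, hS,
        dotProduct_covariance_mulVec (limitModel μ) hmem]
      simp [quadraticSum]
    rw [hlimit]
    exact hmain.congr fun n => (charFun_errorVector hX hindep hident hω hCL n (k n) u).symm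
  have hcomp := hYdist.continuous_comp (matrixOfVector d).continuous
  refine ⟨G.map (matrixOfVector d), hνprob, hg1, hg2, hg3, hg4, ?_⟩
  have heq : (fun (n : ℕ) (w : Ω) => Real.sqrt (k n) •
      (empMoment ω X n (k n) w - condMoment P ω (X 0) (tailQuantile P (X 0) n (k n)))) =
      fun n => matrixOfVector d ∘ errorVector P ω X n (k n) := rfl
  rw [heq]
  refine ⟨hcomp.forall_aemeasurable, aemeasurable_id, ?_⟩
  have ht := hcomp.tendsto
  simp only [Function.comp_id] at ht
  simpa only [Measure.map_id] using ht
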